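/- There is an absolute constant $c>0$ with the following property. Let $f$ be analytic in the unit disc $\mathbb{D}=\{z\in\mathbb{C}\colon |z|<1\}$, with $f(0)=0$ and $f\not\equiv 0$. Let $S=\{w\in\mathbb{C}\colon 0<|w|<\infty,\ \theta_1<\arg w<\theta_2\}$ be any sector with vertex at the origin and opening $\alpha=\theta_2-\theta_1$, $0<\alpha\le 2\pi$ (here $w\in S$ means that some value of $\arg w$ lies in $(\theta_1,\theta_2)$). Then \[ \frac{\operatorname{Area}\big(f^{-1}S\cap\mathbb{D}\big)}{\operatorname{Area}(\mathbb{D})}\ \ge\ \frac{c\,\alpha}{\log\beta^*(\mathbb{D},f)}, \] where \[ \beta^*(\mathbb{D},f)=\max\big(\beta(\mathbb{D},f),\,2\big),\qquad \beta(\mathbb{D},f)=\log\frac{\sup_{|z|<1}|f(z)|}{\max_{|z|\le 1/2}|f(z)|} \] is built from the doubling exponent $\beta$ of $f$ on $\mathbb{D}$. If $f$ is unbounded in $\mathbb{D}$, then $\beta=\beta^*=\log\beta^*=+\infty$ and the right-hand side is read as $0$. -/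

import Mathlib

open scoped ENNReal

/-- The open sector `{w : 0 < |w| < ∞, θ₁ < arg w < θ₂}` with vertex at the origin, where `arg` is
the multivalued argument: some value of the argument of `w` lies in `(θ₁, θ₂)`.
Its opening is `θ₂ - θ₁`. -/
def sector (θ₁ θ₂ : ℝ) : Set ℂ :=
  {w | ∃ ρ θ : ℝ, 0 < ρ ∧ θ₁ < θ ∧ θ < θ₂ ∧ w = ρ * Complex.exp (θ * Complex.I)}

/-- The relative area `Area (f⁻¹ S ∩ rD) / Area (rD)`, where `rD = {z : |z| < r}`. -/
noncomputable def relativeArea (r : ℝ) (S : Set ℂ) (f : ℂ → ℂ) : ℝ≥0∞ :=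
  MeasureTheory.volume (f ⁻¹' S ∩ Metric.ball 0 r) / MeasureTheory.volume (Metric.ball (0 : ℂ) r)

/-- The doubling exponent `log (sup_D |f| / max_{D/2} |f|)` of `f` on the open disc `D` with
centre `a` and radius `R`; here `D/2` is the closed concentric disc of radius `R/2`.
The value is `⊤` if `f` is unbounded on `D`. -/
noncomputable def doublingExponent (a : ℂ) (R : ℝ) (f : ℂ → ℂ) : EReal :=
  ENNReal.log ((⨆ z ∈ Metric.ball a R, ‖f z‖ₑ) / (⨆ z ∈ Metric.closedBall a (R / 2), ‖f z‖ₑ))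

/-- `β* = max (β, 2)`. -/
noncomputable def doublingExponentStar (a : ℂ) (R : ℝ) (f : ℂ → ℂ) : EReal :=
  max (doublingExponent a R f) 2

/-- The logarithm of `x ∈ [0, ∞]`, with `log ∞ = ∞`. -/
noncomputable def elog (x : EReal) : EReal := ENNReal.log x.toENNReal

/-! Let `m t` be the logarithm of the maximum of `|f|` on `|z| ≤ eᵗ`, and suppose `B = β*` is
finite. By Hadamard `m` is convex, and its slopes on `[-2 log 2, -log 2]` are at most `4 B`. Cut
this interval at the points `a j` where the slope passes `2 ^ j`; there are only `O(log B)` pieces.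
If a piece has length `ℓ` with `2 ^ j * ℓ` at least a constant, the corresponding annulus contains a
disc of radius comparable to `ℓ` in which the preimage of a sector of opening `α` has area at least
`c α ℓ²` (`exists_le_volume_preimage_sector_annulus`). By Cauchy–Schwarz, `O(log B)` lengths with a
fixed total have sum of squares at least `c / log B` (`le_sum_sq_of_sum_le`).

The local estimate is `exists_le_volume_preimage_sector_of_growth`. After rescaling, `|f 0| ≥ eⁿ`,
`|f| ≤ e⁹ⁿ`, and each circle `|z| = s` with `1/4 ≤ s ≤ 1/2` meets `{|f| ≤ 1}`. So `log |f|` varies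
by at least `n` on almost every such circle, and `|f' / f|` has integral at least `n / 4` over the
annulus. On the other hand `f` has `O(n)` zeros `a` in the relevant disc, and `|f' / f|` is at most
`O(n)` plus the sum of `1 / |z - a|`, so the integral cannot concentrate on a set of small area.
Hence, on a set of points `w` of area bounded below, `|f' / f|` is comparable to `n` and no zero is
within a fixed multiple of `1 / n`. Near such `w` a branch of `log f` is almost affine and its image
contains a disc much larger than `2π`; the preimage of the sector therefore has area at least `c α /
n²` in a disc of radius `C / n` about `w`. Averaging over `w` gives `c α`.

If instead the slopes stay below a fixed constant on half of the interval, `f` has bounded doubling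
on a fixed disc. Here `f 0 = 0` enters: by Borel–Carathéodory `f` covers a disc about `0` of radius
comparable to its maximum (`ball_subset_image_of_doubling`), and Cauchy's bound on `f'` turns this
into area at least `c α`. -/

/-! ### Area distortion under holomorphic maps -/

theorem abs_det_restrictScalars_toSpanSingleton (a : ℂ) :
    |((ContinuousLinearMap.toSpanSingleton ℂ a).restrictScalars ℝ : ℂ →L[ℝ] ℂ).det| = ‖a‖ ^ 2 := by
  have h1 : (((ContinuousLinearMap.toSpanSingleton ℂ a).restrictScalars ℝ : ℂ →L[ℝ] ℂ) : ℂ →ₗ[ℝ] ℂ)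
      = Algebra.lmul ℝ ℂ a := by
    ext x
    simp [mul_comm]
  have h2 : ((ContinuousLinearMap.toSpanSingleton ℂ a).restrictScalars ℝ : ℂ →L[ℝ] ℂ).det
      = Complex.normSq a := by
    rw [ContinuousLinearMap.det, h1, ← Algebra.norm_apply, Algebra.norm_complex_eq]
    rfl
  rw [h2, abs_of_nonneg (Complex.normSq_nonneg _), Complex.normSq_eq_norm_sq]

/-- A holomorphic map with derivative bounded by `B` expands areas by a factor at most `B ^ 2`. -/
theorem volume_image_le_of_norm_deriv_le {G G' : ℂ → ℂ} {A : Set ℂ} {B : ℝ} (hA : MeasurableSet A)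
    (hG : ∀ z ∈ A, HasDerivAt G (G' z) z) (hB : ∀ z ∈ A, ‖G' z‖ ≤ B) :
    MeasureTheory.volume (G '' A) ≤ ENNReal.ofReal (B ^ 2) * MeasureTheory.volume A := by
  refine (MeasureTheory.addHaar_image_le_lintegral_abs_det_fderiv MeasureTheory.volume
    (f' := fun z => (ContinuousLinearMap.toSpanSingleton ℂ (G' z)).restrictScalars ℝ) hA
    (fun z hz => ((hG z hz).hasFDerivAt.restrictScalars ℝ).hasFDerivWithinAt)).trans ?_
  rw [← MeasureTheory.setLIntegral_const]
  refine MeasureTheory.setLIntegral_mono' hA fun z hz => ENNReal.ofReal_le_ofReal ?_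
  rw [abs_det_restrictScalars_toSpanSingleton]
  exact pow_le_pow_left₀ (norm_nonneg _) (hB z hz) 2

theorem le_volume_image_of_le_norm_deriv {G G' : ℂ → ℂ} {A : Set ℂ} {B : ℝ} (hA : MeasurableSet A)
    (hG : ∀ z ∈ A, HasDerivAt G (G' z) z) (hinj : Set.InjOn G A) (hB0 : 0 ≤ B)
    (hB : ∀ z ∈ A, B ≤ ‖G' z‖) :
    ENNReal.ofReal (B ^ 2) * MeasureTheory.volume A ≤ MeasureTheory.volume (G '' A) := by
  rw [← MeasureTheory.lintegral_abs_det_fderiv_eq_addHaar_image MeasureTheory.volume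
    (f' := fun z => (ContinuousLinearMap.toSpanSingleton ℂ (G' z)).restrictScalars ℝ) hA
    (fun z hz => ((hG z hz).hasFDerivAt.restrictScalars ℝ).hasFDerivWithinAt) hinj]
  rw [← MeasureTheory.setLIntegral_const]
  refine MeasureTheory.setLIntegral_mono' hA fun z hz => ENNReal.ofReal_le_ofReal ?_
  rw [abs_det_restrictScalars_toSpanSingleton]
  exact pow_le_pow_left₀ hB0 (hB z hz) 2

/-! ### Rectangles and sectors in logarithmic coordinates -/

/-- The open rectangle `(a, b) × (c, d)`. -/
def openRect (a b c d : ℝ) : Set ℂ := {z | (a < z.re ∧ z.re < b) ∧ (c < z.im ∧ z.im < d)}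

theorem isOpen_openRect (a b c d : ℝ) : IsOpen (openRect a b c d) := by
  unfold openRect
  have h1 := Complex.continuous_re
  have h2 := Complex.continuous_im
  exact ((isOpen_lt continuous_const h1).inter (isOpen_lt h1 continuous_const)).inter
    ((isOpen_lt continuous_const h2).inter (isOpen_lt h2 continuous_const))

theorem volume_openRect (a b c d : ℝ) :
    MeasureTheory.volume (openRect a b c d) = ENNReal.ofReal (b - a) * ENNReal.ofReal (d - c) := by
  have : openRect a b c d = Complex.measurableEquivRealProd ⁻¹' (Set.Ioo a b ×ˢ Set.Ioo c d) := by
    ext z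
    simp [openRect, Complex.measurableEquivRealProd_apply]
  rw [this, Complex.volume_preserving_equiv_real_prod.measure_preimage_equiv,
    MeasureTheory.Measure.volume_eq_prod, MeasureTheory.Measure.prod_prod, Real.volume_Ioo,
    Real.volume_Ioo]

theorem mem_sector_iff {θ₁ θ₂ : ℝ} {w : ℂ} :
    w ∈ sector θ₁ θ₂ ↔ ∃ ζ : ℂ, θ₁ < ζ.im ∧ ζ.im < θ₂ ∧ w = Complex.exp ζ := by
  constructor
  · rintro ⟨ρ, θ, hρ, h1, h2, rfl⟩
    refine ⟨Real.log ρ + θ * Complex.I, by simpa using h1, by simpa using h2, ?_⟩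
    rw [Complex.exp_add, ← Complex.ofReal_exp, Real.exp_log hρ]
  · rintro ⟨ζ, h1, h2, rfl⟩
    refine ⟨Real.exp ζ.re, ζ.im, Real.exp_pos _, h1, h2, ?_⟩
    rw [Complex.ofReal_exp, ← Complex.exp_add, Complex.re_add_im]

theorem isOpen_sector (θ₁ θ₂ : ℝ) : IsOpen (sector θ₁ θ₂) := by
  have : sector θ₁ θ₂ = Complex.exp '' {ζ | θ₁ < ζ.im ∧ ζ.im < θ₂} := by
    ext w
    rw [mem_sector_iff]
    constructor
    · rintro ⟨ζ, h1, h2, rfl⟩; exact ⟨ζ, ⟨h1, h2⟩, rfl⟩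
    · rintro ⟨ζ, ⟨h1, h2⟩, rfl⟩; exact ⟨ζ, h1, h2, rfl⟩
  rw [this]
  refine Complex.isOpenMap_exp _ ?_
  have h2 := Complex.continuous_im
  exact (isOpen_lt continuous_const h2).inter (isOpen_lt h2 continuous_const)

theorem mul_mem_sector {θ₁ θ₂ c : ℝ} (hc : 0 < c) {w : ℂ} :
    (c : ℂ) * w ∈ sector θ₁ θ₂ ↔ w ∈ sector θ₁ θ₂ := by
  constructor
  · rintro ⟨ρ, θ, hρ, h1, h2, h⟩
    refine ⟨c⁻¹ * ρ, θ, by positivity, h1, h2, ?_⟩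
    have : (c : ℂ) ≠ 0 := by exact_mod_cast hc.ne'
    push_cast
    rw [mul_assoc, ← h, inv_mul_cancel_left₀ this]
  · rintro ⟨ρ, θ, hρ, h1, h2, rfl⟩
    exact ⟨c * ρ, θ, by positivity, h1, h2, by push_cast; ring⟩

/-- The part of a sector of opening `α` in a disc of radius `ρ` has area at least `α ρ² / e²`. -/
theorem le_volume_sector_inter_ball {θ₁ θ₂ ρ : ℝ} (hθ : θ₂ - θ₁ ≤ 2 * Real.pi)
    (hρ : 0 < ρ) :
    ENNReal.ofReal ((ρ * Real.exp (-1)) ^ 2) * ENNReal.ofReal (θ₂ - θ₁) ≤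
      MeasureTheory.volume (sector θ₁ θ₂ ∩ Metric.ball 0 ρ) := by
  have hsub : Complex.exp '' openRect (Real.log ρ - 1) (Real.log ρ) θ₁ θ₂ ⊆
      sector θ₁ θ₂ ∩ Metric.ball 0 ρ := by
    rintro _ ⟨ζ, ⟨⟨h1, h2⟩, h3, h4⟩, rfl⟩
    refine ⟨mem_sector_iff.2 ⟨ζ, h3, h4, rfl⟩, ?_⟩
    rw [mem_ball_zero_iff, Complex.norm_exp]
    exact (Real.lt_log_iff_exp_lt hρ).1 h2
  refine le_trans ?_ (MeasureTheory.measure_mono hsub)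
  have := le_volume_image_of_le_norm_deriv (G := Complex.exp) (G' := Complex.exp)
    (A := openRect (Real.log ρ - 1) (Real.log ρ) θ₁ θ₂) (B := ρ * Real.exp (-1))
    (isOpen_openRect _ _ _ _).measurableSet (fun z _ => Complex.hasDerivAt_exp z) ?_ (by positivity) ?_
  · rwa [volume_openRect, sub_sub_cancel, ENNReal.ofReal_one, one_mul] at this
  -- Imaginary parts in the open rectangle differ by less than `θ₂ - θ₁ ≤ 2π`, so `exp` is injective
  -- there.
  · rintro z ⟨_, h1, h2⟩ w ⟨_, h3, h4⟩ h
    obtain ⟨n, hn⟩ := Complex.exp_eq_exp_iff_exists_int.1 h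
    have him : z.im = w.im + n * (2 * Real.pi) := by
      have := congrArg Complex.im hn
      simpa using this
    have hpi := Real.pi_pos
    have hn0 : n = 0 := by
      have ha : (n : ℝ) < 1 := by
        by_contra hc
        push Not at hc
        nlinarith
      have hb : (-1 : ℝ) < n := by
        by_contra hc
        push Not at hc
        nlinarith
      have ha' : n < 1 := by exact_mod_cast ha
      have hb' : -1 < n := by exact_mod_cast hb
      omega
    simpa [hn0] using hn
  · rintro z ⟨⟨h1, _⟩, _⟩
    rw [Complex.norm_exp, ← Real.exp_log hρ, ← Real.exp_add]
    exact Real.exp_le_exp.2 (by linarith)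

/-! ### Logarithms and Blaschke factorization -/

/-- A zero-free holomorphic function on a disc has a holomorphic logarithm. -/
theorem exists_log_on_ball {f : ℂ → ℂ} {c : ℂ} {R : ℝ} (hR : 0 < R)
    (hf : DifferentiableOn ℂ f (Metric.ball c R)) (h0 : ∀ z ∈ Metric.ball c R, f z ≠ 0) :
    ∃ g : ℂ → ℂ, (∀ z ∈ Metric.ball c R, HasDerivAt g (deriv f z / f z) z) ∧
      ∀ z ∈ Metric.ball c R, f z = Complex.exp (g z) := by
  have hd : DifferentiableOn ℂ (fun z => deriv f z / f z) (Metric.ball c R) :=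
    (hf.deriv Metric.isOpen_ball).div hf h0
  -- With this normalisation at the centre, `f * exp (-g)` has zero derivative and equals `1` at
  -- `c`.
  obtain ⟨g, hgc, hg⟩ := hd.isExactOn_ball.with_val_at c (Complex.log (f c))
  have hc : c ∈ Metric.ball c R := Metric.mem_ball_self hR
  refine ⟨g, fun z hz => hg z hz, fun z hz => ?_⟩
  have key : ∀ z ∈ Metric.ball c R, HasDerivAt (fun z => f z * Complex.exp (-g z)) 0 z := by
    intro z hz
    have h1 := (hf.differentiableAt (Metric.isOpen_ball.mem_nhds hz)).hasDerivAt
    have h2 := h1.mul (hg z hz).neg.cexp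
    refine h2.congr_deriv ?_
    have := h0 z hz
    have e : f z * (Complex.exp (-g z) * -(deriv f z / f z)) = -(deriv f z * Complex.exp (-g z)) := by
      field_simp
    exact (congrArg (deriv f z * Complex.exp (-g z) + ·) e).trans (add_neg_cancel _)
  have hconst : f z * Complex.exp (-g z) = f c * Complex.exp (-g c) := by
    refine Metric.isOpen_ball.is_const_of_deriv_eq_zero (convex_ball c R).isPreconnected
      (fun z hz => (key z hz).differentiableAt.differentiableWithinAt)
      (fun z hz => (key z hz).deriv) hz hc
  rw [hgc, Complex.exp_neg (Complex.log _), Complex.exp_log (h0 c hc), mul_inv_cancel₀ (h0 c hc),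
    Complex.exp_neg] at hconst
  exact eq_of_mul_inv_eq_one hconst

/-- Factoring out one Blaschke factor. -/
theorem exists_blaschke_quotient {f : ℂ → ℂ} {a : ℂ} {M : ℝ}
    (hf : AnalyticOnNhd ℂ f (Metric.closedBall 0 1))
    (hM : ∀ z ∈ Metric.closedBall (0 : ℂ) 1, ‖f z‖ ≤ M) (ha : ‖a‖ < 1) (hfa : f a = 0) :
    ∃ f₁ : ℂ → ℂ, AnalyticOnNhd ℂ f₁ (Metric.closedBall 0 1) ∧
      (∀ z ∈ Metric.closedBall (0 : ℂ) 1, ‖f₁ z‖ ≤ M) ∧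
      ∀ z ∈ Metric.closedBall (0 : ℂ) 1,
        f z = (z - a) / (1 - (starRingEnd ℂ) a * z) * f₁ z := by
  have hden : ∀ z ∈ Metric.closedBall (0 : ℂ) 1, 1 - (starRingEnd ℂ) a * z ≠ 0 := by
    intro z hz h
    rw [mem_closedBall_zero_iff] at hz
    have h1 : ‖(starRingEnd ℂ) a * z‖ = 1 := by rw [← sub_eq_zero.1 h, norm_one]
    rw [norm_mul, Complex.norm_conj] at h1
    nlinarith [norm_nonneg a, norm_nonneg z]
  have hfac : ∀ z, f z = (z - a) * dslope f a z := by
    intro z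
    have := sub_smul_dslope f a z
    rw [hfa, sub_zero, smul_eq_mul] at this
    exact this.symm
  have haball : a ∈ Metric.closedBall (0 : ℂ) 1 := by
    rw [mem_closedBall_zero_iff]; exact ha.le
  have hds : AnalyticOnNhd ℂ (dslope f a) (Metric.closedBall 0 1) := by
    intro z hz
    rcases eq_or_ne z a with rfl | hza
    · obtain ⟨p, hp⟩ := hf z hz
      exact ⟨_, hp.has_fpower_series_dslope_fslope⟩
    · have h1 : AnalyticAt ℂ (fun w => (w - a)⁻¹ * f w) z :=
        ((analyticAt_id.sub analyticAt_const).inv (sub_ne_zero.2 hza)).mul (hf z hz)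
      refine h1.congr ?_
      filter_upwards [isOpen_ne.mem_nhds hza] with w hw
      rw [hfac w, inv_mul_cancel_left₀ (sub_ne_zero.2 hw)]
  have han : AnalyticOnNhd ℂ (fun z => (1 - (starRingEnd ℂ) a * z) * dslope f a z)
      (Metric.closedBall 0 1) := fun z hz =>
    (analyticAt_const.sub (analyticAt_const.mul analyticAt_id)).mul (hds z hz)
  refine ⟨fun z => (1 - (starRingEnd ℂ) a * z) * dslope f a z, han, ?_, ?_⟩
  · intro z hz
    -- Maximum principle: on the unit circle `|1 - ā w| = |w - a|`, so the quotient has the modulus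
    -- of `f` there and inherits its bound.
    refine Complex.norm_le_of_forall_mem_frontier_norm_le (U := Metric.ball (0 : ℂ) 1)
      (f := fun z => (1 - (starRingEnd ℂ) a * z) * dslope f a z)
      Metric.isBounded_ball ?_ ?_ ?_
    · refine DifferentiableOn.diffContOnCl ?_
      rw [closure_ball _ one_ne_zero]
      exact han.differentiableOn
    · intro w hw
      rw [frontier_ball _ one_ne_zero] at hw
      have hw1 : ‖w‖ = 1 := by simpa using hw
      have hwc : w ∈ Metric.closedBall (0 : ℂ) 1 := Metric.sphere_subset_closedBall hw
      have hnorm : ‖1 - (starRingEnd ℂ) a * w‖ = ‖w - a‖ := by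
        have hwne : w ≠ 0 := by rw [← norm_ne_zero_iff, hw1]; exact one_ne_zero
        have h2 : (starRingEnd ℂ) w * w = 1 := by
          rw [mul_comm, Complex.mul_conj, Complex.normSq_eq_norm_sq, hw1]; simp
        have h3 : 1 - (starRingEnd ℂ) a * w = (starRingEnd ℂ) (w - a) * w := by
          rw [map_sub, sub_mul, h2]
        rw [h3, norm_mul, Complex.norm_conj, hw1, mul_one]
      have := hM w hwc
      rw [hfac w, norm_mul] at this
      rwa [norm_mul, hnorm]
    · rw [closure_ball _ one_ne_zero]; exact hz
  · intro z hz
    rw [hfac z]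
    have := hden z hz
    rw [div_mul_eq_mul_div, eq_div_iff this]
    ring

/-- Factoring out all zeros in a disc, with control of their number. -/
theorem exists_blaschke_factorization {M : ℝ} (k : ℕ) :
    ∀ f : ℂ → ℂ, AnalyticOnNhd ℂ f (Metric.closedBall 0 1) →
      (∀ z ∈ Metric.closedBall (0 : ℂ) 1, ‖f z‖ ≤ M) → M < ‖f 0‖ * (4 / 3) ^ k →
      ∃ (l : List ℂ) (h : ℂ → ℂ), l.length ≤ k ∧ (∀ a ∈ l, ‖a‖ ≤ 3 / 4) ∧
        AnalyticOnNhd ℂ h (Metric.closedBall 0 1) ∧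
        (∀ z ∈ Metric.closedBall (0 : ℂ) 1, ‖h z‖ ≤ M) ∧
        (∀ z ∈ Metric.closedBall (0 : ℂ) (3 / 4), h z ≠ 0) ∧ ‖f 0‖ ≤ ‖h 0‖ ∧
        ∀ z ∈ Metric.closedBall (0 : ℂ) 1,
          f z = (l.map fun a => (z - a) / (1 - (starRingEnd ℂ) a * z)).prod * h z := by
  have h0mem : (0 : ℂ) ∈ Metric.closedBall (0 : ℂ) 1 := by simp
  induction k with
  | zero =>
    intro f _ hM hk
    have := hM 0 h0mem
    simp at hk
    linarith
  | succ k ih =>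
    intro f hf hM hk
    by_cases hz : ∀ z ∈ Metric.closedBall (0 : ℂ) (3 / 4), f z ≠ 0
    · exact ⟨[], f, by simp, by simp, hf, hM, hz, le_rfl, by simp⟩
    push Not at hz
    obtain ⟨a, ha, hfa⟩ := hz
    rw [mem_closedBall_zero_iff] at ha
    obtain ⟨f₁, hf₁, hM₁, hfac⟩ := exists_blaschke_quotient hf hM (by linarith) hfa
    have hf0 : ‖f 0‖ = ‖a‖ * ‖f₁ 0‖ := by
      rw [hfac 0 h0mem]; simp
    -- Jensen's formula in disguise: each zero removed raises the value at `0` by a factor at least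
    -- `4 / 3` while the bound `M` stays, so at most `k` zeros can be removed.
    have hle : ‖f 0‖ ≤ 3 / 4 * ‖f₁ 0‖ := by
      rw [hf0]; exact mul_le_mul_of_nonneg_right ha (norm_nonneg _)
    have hk₁ : M < ‖f₁ 0‖ * (4 / 3) ^ k := by
      refine hk.trans_le ?_
      rw [pow_succ]
      have : (0 : ℝ) < (4 / 3) ^ k := by positivity
      nlinarith
    obtain ⟨l, h, hl, hla, hh, hhM, hh0, hh00, hhf⟩ := ih f₁ hf₁ hM₁ hk₁
    refine ⟨a :: l, h, by simpa using hl, ?_, hh, hhM, hh0, ?_, ?_⟩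
    · intro b hb
      rcases List.mem_cons.1 hb with rfl | hb
      · exact ha
      · exact hla b hb
    · nlinarith [norm_nonneg (f₁ 0)]
    · intro z hz
      rw [hfac z hz, hhf z hz, List.map_cons, List.prod_cons, mul_assoc]

/-! ### Covering by a branch of log f at scale 1/n -/

/-- Near a point where the logarithmic derivative of `f` has size about `n` and varies slowly at
the scale `1 / n`, the values of `f` fill a fixed proportion of every sector. -/
theorem le_volume_preimage_sector_of_logDeriv {f : ℂ → ℂ} {w : ℂ} {n L : ℝ} {θ₁ θ₂ : ℝ}
    (hn : 0 < n) (hL : 1 ≤ L)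
    (hf : DifferentiableOn ℂ f (Metric.ball w (81920 * L / n)))
    (h0 : ∀ z ∈ Metric.ball w (81920 * L / n), f z ≠ 0)
    (hup : ∀ z ∈ Metric.ball w (81920 * L / n), ‖deriv f z / f z‖ ≤ L * n)
    (hlow : n / 8 ≤ ‖deriv f w / f w‖) (hθ : θ₂ - θ₁ ≤ 2 * Real.pi) :
    ENNReal.ofReal (θ₂ - θ₁) ≤ ENNReal.ofReal ((L * n) ^ 2) *
      MeasureTheory.volume (f ⁻¹' sector θ₁ θ₂ ∩ Metric.ball w (81920 * L / n)) := by
  set δ : ℝ := 81920 * L / n with hδ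
  have hδ0 : 0 < δ := by positivity
  set F : ℂ → ℂ := fun z => deriv f z / f z with hF
  have hw : w ∈ Metric.ball w δ := Metric.mem_ball_self hδ0
  obtain ⟨G, hG, hfG⟩ := exists_log_on_ball hδ0 hf h0
  have hFd : DifferentiableOn ℂ F (Metric.ball w δ) := (hf.deriv Metric.isOpen_ball).div hf h0
  -- Schwarz's lemma for `F - F w`, which is bounded by `2 L n`. Since `2 * 640 / 81920 = 1 / 64`,
  -- the variation on the disc of radius `ρ = 640 / n` is at most `n / 64`.
  have hFlip : ∀ z ∈ Metric.ball w δ, ‖F z - F w‖ ≤ 2 * L * n / δ * ‖z - w‖ := by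
    intro z hz
    have := Complex.dist_le_div_mul_dist_of_mapsTo_ball (R₂ := 2 * L * n) hFd ?_ hz
    · rwa [dist_eq_norm, dist_eq_norm] at this
    · intro x hx
      rw [Metric.mem_closedBall, dist_eq_norm]
      refine (norm_sub_le _ _).trans ?_
      have h1 := hup x hx
      have h2 := hup w hw
      change ‖F x‖ ≤ _ at h1
      change ‖F w‖ ≤ _ at h2
      linarith
  set ρ : ℝ := 640 / n with hρ
  have hρ0 : 0 < ρ := by positivity
  have hρδ : ρ < δ := by
    rw [hρ, hδ]
    refine div_lt_div_of_pos_right ?_ hn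
    linarith
  have hsub : Metric.closedBall w ρ ⊆ Metric.ball w δ := Metric.closedBall_subset_ball hρδ
  have hFn : ∀ z ∈ Metric.closedBall w ρ, ‖F z - F w‖ ≤ n / 64 := by
    intro z hz
    refine (hFlip z (hsub hz)).trans ?_
    have hz' : ‖z - w‖ ≤ ρ := by rwa [← dist_eq_norm]
    calc 2 * L * n / δ * ‖z - w‖ ≤ 2 * L * n / δ * ρ := by gcongr
      _ = n / 64 := by rw [hρ, hδ]; field_simp; norm_num
  have hlin : ∀ z ∈ Metric.closedBall w ρ, ‖G z - G w - F w * (z - w)‖ ≤ n / 64 * ‖z - w‖ := by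
    intro z hz
    have := (convex_closedBall w ρ).norm_image_sub_le_of_norm_hasDerivWithin_le
      (f := fun z => G z - F w * (z - w)) (f' := fun z => F z - F w * 1) (C := n / 64)
      (fun x hx => ((hG x (hsub hx)).sub
        (((hasDerivAt_id x).sub_const w).const_mul (F w))).hasDerivWithinAt)
      (fun x hx => by rw [mul_one]; exact hFn x hx) (Metric.mem_closedBall_self hρ0.le) hz
    have e : G z - G w - F w * (z - w) = (G z - F w * (z - w)) - (G w - F w * (w - w)) := by ring
    rwa [e]
  have hsphere : ∀ z ∈ Metric.sphere w ρ, 70 ≤ ‖G z - G w‖ := by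
    intro z hz
    have hz' : ‖z - w‖ = ρ := by rw [← dist_eq_norm]; exact hz
    have h1 := hlin z (Metric.sphere_subset_closedBall hz)
    have h2 : ‖F w * (z - w)‖ ≤ ‖G z - G w‖ + ‖G z - G w - F w * (z - w)‖ := by
      have := norm_sub_le (G z - G w) (G z - G w - F w * (z - w))
      rwa [sub_sub_cancel] at this
    rw [norm_mul, hz'] at h2
    rw [hz'] at h1
    have h3 : n / 8 * ρ ≤ ‖F w‖ * ρ := mul_le_mul_of_nonneg_right hlow hρ0.le
    have h4 : n / 8 * ρ = 80 := by rw [hρ]; field_simp; norm_num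
    have h5 : n / 64 * ρ = 10 := by rw [hρ]; field_simp; norm_num
    linarith
  -- On the circle the affine part has size at least `80` and the error at most `10`; a displacement
  -- of at least `70` on the boundary forces the image to contain the disc of half that radius.
  have hball : Metric.ball (G w) 35 ⊆ G '' Metric.closedBall w ρ := by
    have hdc : DiffContOnCl ℂ G (Metric.ball w ρ) := by
      refine DifferentiableOn.diffContOnCl ?_
      rw [closure_ball _ hρ0.ne']
      exact fun z hz => (hG z (hsub hz)).differentiableAt.differentiableWithinAt
    have hfreq : ∃ᶠ z in nhds w, G z ≠ G w := by
      intro hev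
      simp only [not_not] at hev
      have hd : HasDerivAt G 0 w :=
        (hasDerivAt_const w (G w)).congr_of_eventuallyEq hev
      have hFw : F w = 0 := (hG w hw).unique hd
      have : n / 8 ≤ ‖F w‖ := hlow
      rw [hFw, norm_zero] at this
      linarith
    have := hdc.ball_subset_image_closedBall hρ0 hsphere hfreq
    norm_num at this
    exact this
  -- The translate by `2πk` of the strip over the sector comes within `2π < 8` of `G w`, so a piece
  -- of it of width `1` fits into the disc of radius `35`.
  set k : ℤ := ⌊((G w).im - θ₁) / (2 * Real.pi)⌋ with hk
  have hpi := Real.pi_pos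
  have hpi4 := Real.pi_lt_four
  have hk1 : (k : ℝ) * (2 * Real.pi) ≤ (G w).im - θ₁ := by
    rw [← le_div_iff₀ (by positivity)]
    exact Int.floor_le _
  have hk2 : (G w).im - θ₁ < (k + 1 : ℝ) * (2 * Real.pi) := by
    rw [← div_lt_iff₀ (by positivity)]
    exact Int.lt_floor_add_one _
  set A : Set ℂ := f ⁻¹' sector θ₁ θ₂ ∩ Metric.ball w δ with hA
  have hAm : MeasurableSet A := by
    have := hf.continuousOn.isOpen_inter_preimage Metric.isOpen_ball (isOpen_sector θ₁ θ₂)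
    rw [Set.inter_comm] at this
    exact this.measurableSet
  have hrect : openRect (G w).re ((G w).re + 1) (θ₁ + k * (2 * Real.pi))
      (θ₂ + k * (2 * Real.pi)) ⊆ G '' A := by
    rintro ζ ⟨⟨h1, h2⟩, h3, h4⟩
    have hζ : ζ ∈ Metric.ball (G w) 35 := by
      rw [Metric.mem_ball, dist_eq_norm]
      refine (Complex.norm_le_abs_re_add_abs_im _).trans_lt ?_
      have ha : |(ζ - G w).re| < 1 := by
        rw [Complex.sub_re, abs_lt]; constructor <;> linarith
      have hb : |(ζ - G w).im| < 8 := by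
        rw [Complex.sub_im, abs_lt]; constructor <;> nlinarith
      linarith
    obtain ⟨z, hz, rfl⟩ := hball hζ
    refine ⟨z, ⟨?_, hsub hz⟩, rfl⟩
    rw [Set.mem_preimage, mem_sector_iff]
    refine ⟨G z - k * (2 * Real.pi * Complex.I), ?_, ?_, ?_⟩
    · simp; linarith
    · simp; linarith
    · rw [hfG z (hsub hz), Complex.exp_eq_exp_iff_exists_int]
      exact ⟨k, by ring⟩
  have := (MeasureTheory.measure_mono hrect).trans
    (volume_image_le_of_norm_deriv_le hAm (fun z hz => hG z hz.2) (fun z hz => hup z hz.2))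
  rw [volume_openRect] at this
  simpa using this

/-! ### Integrals of 1/|z - a| and of f'/f -/

/-- Integration in polar coordinates. -/
theorem lintegral_eq_lintegral_polar {Φ : ℂ → ℝ≥0∞} (hΦ : Measurable Φ) :
    ∫⁻ z, Φ z = ∫⁻ s in Set.Ioi (0 : ℝ), ENNReal.ofReal s *
      ∫⁻ θ in Set.Ioo (-Real.pi) Real.pi, Φ (s * Complex.exp (θ * Complex.I)) := by
  have hmeas : Measurable fun p : ℝ × ℝ => Φ (p.1 * Complex.exp (p.2 * Complex.I)) :=
    hΦ.comp (Continuous.measurable (by fun_prop))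
  rw [← Complex.lintegral_comp_polarCoord_symm, polarCoord_target, MeasureTheory.Measure.volume_eq_prod]
  have hsymm : ∀ p : ℝ × ℝ, Complex.polarCoord.symm p = p.1 * Complex.exp (p.2 * Complex.I) := by
    intro p
    rw [Complex.polarCoord_symm_apply, Complex.exp_mul_I, Complex.ofReal_cos, Complex.ofReal_sin]
  simp_rw [hsymm, smul_eq_mul]
  rw [MeasureTheory.setLIntegral_prod]
  · refine MeasureTheory.setLIntegral_congr_fun measurableSet_Ioi fun s _ => ?_
    exact MeasureTheory.lintegral_const_mul (ENNReal.ofReal s)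
      (f := fun θ : ℝ => Φ (s * Complex.exp (θ * Complex.I))) (hmeas.comp measurable_prodMk_left)
  · exact (Measurable.mul (ENNReal.measurable_ofReal.comp measurable_fst) hmeas).aemeasurable

/-- In polar coordinates about `a` the Jacobian `r` cancels the singularity `1 / r`. -/
theorem lintegral_ball_inv_norm_le (s : ℝ) (a : ℂ) :
    ∫⁻ z in Metric.ball a s, ‖z - a‖ₑ⁻¹ ≤ ENNReal.ofReal (2 * Real.pi * s) := by
  have h1 : ∫⁻ z in Metric.ball a s, ‖z - a‖ₑ⁻¹ =
      ∫⁻ z, (Metric.ball (0 : ℂ) s).indicator (fun z => ‖z‖ₑ⁻¹) z := by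
    rw [← MeasureTheory.lintegral_indicator Metric.isOpen_ball.measurableSet,
      ← MeasureTheory.lintegral_sub_right_eq_self
        ((Metric.ball (0 : ℂ) s).indicator fun z => ‖z‖ₑ⁻¹) a]
    congr 1
    ext z
    by_cases hz : z ∈ Metric.ball a s
    · rw [Set.indicator_of_mem hz, Set.indicator_of_mem]
      simpa [dist_eq_norm] using hz
    · rw [Set.indicator_of_notMem hz, Set.indicator_of_notMem]
      simpa [dist_eq_norm] using hz
  have hm : Measurable ((Metric.ball (0 : ℂ) s).indicator (fun z => ‖z‖ₑ⁻¹)) :=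
    Measurable.indicator (by fun_prop) Metric.isOpen_ball.measurableSet
  rw [h1, lintegral_eq_lintegral_polar hm]
  calc ∫⁻ r in Set.Ioi (0 : ℝ), ENNReal.ofReal r * ∫⁻ θ in Set.Ioo (-Real.pi) Real.pi,
        (Metric.ball (0 : ℂ) s).indicator (fun z => ‖z‖ₑ⁻¹) (r * Complex.exp (θ * Complex.I))
      ≤ ∫⁻ r in Set.Ioi (0 : ℝ), (Set.Iio s).indicator (fun _ => ENNReal.ofReal (2 * Real.pi)) r := by
        refine MeasureTheory.setLIntegral_mono' measurableSet_Ioi fun r hr => ?_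
        have hr : 0 < r := hr
        have hn : ∀ θ : ℝ, ‖(r : ℂ) * Complex.exp (θ * Complex.I)‖ = r := by
          intro θ
          rw [norm_mul, Complex.norm_exp_ofReal_mul_I, mul_one, Complex.norm_real,
            Real.norm_of_nonneg hr.le]
        by_cases hrs : r < s
        · rw [Set.indicator_of_mem (Set.mem_Iio.2 hrs)]
          have : ∀ θ : ℝ, (Metric.ball (0 : ℂ) s).indicator (fun z => ‖z‖ₑ⁻¹)
              (r * Complex.exp (θ * Complex.I)) = (ENNReal.ofReal r)⁻¹ := by
            intro θ
            rw [Set.indicator_of_mem (by rw [mem_ball_zero_iff, hn]; exact hrs),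
              ← ofReal_norm, hn]
          simp_rw [this]
          rw [MeasureTheory.setLIntegral_const, Real.volume_Ioo, ← mul_assoc, ENNReal.mul_inv_cancel
            (ENNReal.ofReal_pos.2 hr).ne' ENNReal.ofReal_ne_top, one_mul]
          refine ENNReal.ofReal_le_ofReal (by linarith)
        · have : ∀ θ : ℝ, (Metric.ball (0 : ℂ) s).indicator (fun z => ‖z‖ₑ⁻¹)
              (r * Complex.exp (θ * Complex.I)) = 0 := by
            intro θ
            rw [Set.indicator_of_notMem (by rw [mem_ball_zero_iff, hn]; exact hrs)]
          simp_rw [this]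
          simp
    _ = ENNReal.ofReal (2 * Real.pi * s) := by
        rw [MeasureTheory.lintegral_indicator measurableSet_Iio,
          MeasureTheory.setLIntegral_const, MeasureTheory.Measure.restrict_apply measurableSet_Iio,
          Set.inter_comm, Set.Ioi_inter_Iio, Real.volume_Ioo, sub_zero,
          ← ENNReal.ofReal_mul (by positivity)]

/-- Over a set `Q` the integral of `1 / |z - a|` is small when the area of `Q` is small. -/
theorem setLIntegral_inv_norm_le {s : ℝ} (hs : 0 < s) (a : ℂ) (Q : Set ℂ) :
    ∫⁻ z in Q, ‖z - a‖ₑ⁻¹ ≤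
      ENNReal.ofReal (2 * Real.pi * s) + ENNReal.ofReal s⁻¹ * MeasureTheory.volume Q := by
  calc ∫⁻ z in Q, ‖z - a‖ₑ⁻¹
      ≤ ∫⁻ z in Q, ((Metric.ball a s).indicator (fun z => ‖z - a‖ₑ⁻¹) z + ENNReal.ofReal s⁻¹) := by
        refine MeasureTheory.lintegral_mono fun z => ?_
        by_cases hz : z ∈ Metric.ball a s
        · rw [Set.indicator_of_mem hz]; exact le_self_add
        · rw [Set.indicator_of_notMem hz, zero_add, ENNReal.ofReal_inv_of_pos hs,
            ENNReal.inv_le_inv, ← ofReal_norm]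
          refine ENNReal.ofReal_le_ofReal ?_
          simpa [dist_eq_norm] using hz
    _ = (∫⁻ z in Q, (Metric.ball a s).indicator (fun z => ‖z - a‖ₑ⁻¹) z) +
          ENNReal.ofReal s⁻¹ * MeasureTheory.volume Q := by
        rw [MeasureTheory.lintegral_add_right _ measurable_const, MeasureTheory.setLIntegral_const]
    _ ≤ _ := by
        gcongr
        refine (MeasureTheory.setLIntegral_le_lintegral _ _).trans ?_
        rw [MeasureTheory.lintegral_indicator Metric.isOpen_ball.measurableSet]
        exact lintegral_ball_inv_norm_le s a

/-- The variation of `log |f|` along a circle is bounded by the integral of `|f' / f|`. -/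
theorem le_lintegral_circle_logDeriv {f : ℂ → ℂ} {s n : ℝ} (hs : 0 < s)
    (hf : ∀ z, ‖z‖ = s → AnalyticAt ℂ f z) (h0 : ∀ z, ‖z‖ = s → f z ≠ 0) {z₁ z₂ : ℂ}
    (hz₁ : ‖z₁‖ = s) (hz₂ : ‖z₂‖ = s) (h₁ : ‖f z₁‖ ≤ 1) (h₂ : Real.exp n ≤ ‖f z₂‖) :
    ENNReal.ofReal n ≤ ENNReal.ofReal s * ∫⁻ θ in Set.Ioo (-Real.pi) Real.pi,
      ‖deriv f (s * Complex.exp (θ * Complex.I)) / f (s * Complex.exp (θ * Complex.I))‖ₑ := by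
  set γ : ℝ → ℂ := fun θ => s * Complex.exp (θ * Complex.I) with hγ
  have hγn : ∀ θ, ‖γ θ‖ = s := by
    intro θ
    simp only [hγ]
    rw [norm_mul, Complex.norm_exp_ofReal_mul_I, mul_one, Complex.norm_real,
      Real.norm_of_nonneg hs.le]
  have hγd : ∀ θ : ℝ, HasDerivAt γ (γ θ * Complex.I) θ := by
    intro θ
    have h1 : HasDerivAt (fun θ : ℝ => (θ : ℂ) * Complex.I) Complex.I θ := by
      simpa using (Complex.ofRealCLM.hasDerivAt (x := θ)).mul_const Complex.I
    have h2 := h1.cexp.const_mul (s : ℂ)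
    refine h2.congr_deriv ?_
    simp only [hγ]; ring
  have hγs : ContDiff ℝ 1 γ := by
    have : ContDiff ℝ 1 fun θ : ℝ => (θ : ℂ) := Complex.ofRealCLM.contDiff
    exact contDiff_const.mul ((this.mul contDiff_const).cexp)
  set φ : ℝ → ℝ := fun θ => Real.log ‖f (γ θ)‖ with hφ
  have hφs : ContDiff ℝ 1 φ := by
    rw [contDiff_iff_contDiffAt]
    intro θ
    have h1 : ContDiffAt ℝ 1 (fun θ => f (γ θ)) θ :=
      (((hf _ (hγn θ)).contDiffAt (n := 1)).restrict_scalars ℝ).comp θ hγs.contDiffAt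
    exact (h1.norm ℝ (h0 _ (hγn θ))).log (norm_ne_zero_iff.2 (h0 _ (hγn θ)))
  have hφd : ∀ θ, ‖deriv φ θ‖ₑ ≤ ENNReal.ofReal s * ‖deriv f (γ θ) / f (γ θ)‖ₑ := by
    intro θ
    have hne := h0 _ (hγn θ)
    have h1 : HasDerivAt (fun θ => f (γ θ)) (deriv f (γ θ) * (γ θ * Complex.I)) θ :=
      (hf _ (hγn θ)).differentiableAt.hasDerivAt.comp θ (hγd θ)
    have h2 : HasDerivAt (fun θ => Real.log (‖f (γ θ)‖ ^ 2) / 2) _ θ :=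
      (h1.norm_sq.log (by positivity)).div_const 2
    have h3 : φ = fun θ => Real.log (‖f (γ θ)‖ ^ 2) / 2 := by
      ext θ; simp only [hφ]; rw [Real.log_pow]; push_cast; ring
    rw [h3, h2.deriv, ← ofReal_norm, ← ofReal_norm,
      ← ENNReal.ofReal_mul hs.le]
    refine ENNReal.ofReal_le_ofReal ?_
    have h4 := norm_inner_le_norm (𝕜 := ℝ) (f (γ θ)) (deriv f (γ θ) * (γ θ * Complex.I))
    rw [norm_mul, norm_mul, hγn, Complex.norm_I, mul_one] at h4
    rw [norm_div, norm_div, norm_mul, norm_div, norm_pow, norm_norm]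
    have hpos : 0 < ‖f (γ θ)‖ := norm_pos_iff.2 hne
    rw [Real.norm_ofNat, div_div, div_le_iff₀ (by positivity)]
    have h5 : s * (‖deriv f (γ θ)‖ / ‖f (γ θ)‖) * (‖f (γ θ)‖ ^ 2 * 2) =
        2 * (‖f (γ θ)‖ * (‖deriv f (γ θ)‖ * s)) := by
      field_simp
    rw [h5]
    exact mul_le_mul_of_nonneg_left h4 zero_le_two
  have harg : ∀ z : ℂ, ‖z‖ = s → γ z.arg = z := by
    intro z hz
    simp only [hγ]
    rw [← hz, Complex.norm_mul_exp_arg_mul_I]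
  have hint : ∀ θ₁ θ₂ : ℝ, -Real.pi < θ₁ → θ₂ ≤ Real.pi → θ₁ ≤ θ₂ → ‖φ θ₂ - φ θ₁‖ₑ ≤
      ENNReal.ofReal s * ∫⁻ θ in Set.Ioo (-Real.pi) Real.pi, ‖deriv f (γ θ) / f (γ θ)‖ₑ := by
    intro θ₁ θ₂ ha hb hab
    refine (enorm_sub_le_lintegral_deriv_of_contDiffOn_Icc hφs.contDiffOn hab).trans ?_
    rw [← MeasureTheory.lintegral_const_mul' _ _ ENNReal.ofReal_ne_top,
      MeasureTheory.restrict_Ioo_eq_restrict_Ioc]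
    exact (MeasureTheory.lintegral_mono_set (Set.Icc_subset_Ioc ha hb)).trans
      (MeasureTheory.lintegral_mono hφd)
  have hφ₁ : φ z₁.arg ≤ 0 := by
    simp only [hφ]
    rw [harg z₁ hz₁]
    exact Real.log_nonpos (norm_nonneg _) h₁
  have hφ₂ : n ≤ φ z₂.arg := by
    simp only [hφ]
    rw [harg z₂ hz₂, Real.le_log_iff_exp_le (norm_pos_iff.2 (h0 _ hz₂))]
    exact h₂
  have hle : ENNReal.ofReal n ≤ ‖φ z₂.arg - φ z₁.arg‖ₑ := by
    rw [← ofReal_norm]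
    exact ENNReal.ofReal_le_ofReal ((by linarith : n ≤ φ z₂.arg - φ z₁.arg).trans (le_abs_self _))
  rcases le_total z₁.arg z₂.arg with h | h
  · exact hle.trans (hint _ _ (Complex.neg_pi_lt_arg _) (Complex.arg_le_pi _) h)
  · refine hle.trans ?_
    rw [enorm_sub_rev]
    exact hint _ _ (Complex.neg_pi_lt_arg _) (Complex.arg_le_pi _) h

/-- The open annulus `1/4 < |z| < 1/2`. -/
def middleAnnulus : Set ℂ := {z | 1 / 4 < ‖z‖ ∧ ‖z‖ < 1 / 2}

theorem measurableSet_middleAnnulus : MeasurableSet middleAnnulus :=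
  ((isOpen_lt continuous_const continuous_norm).inter
    (isOpen_lt continuous_norm continuous_const)).measurableSet

/-- `deriv f` is measurable for every `f`, but `f` itself is controlled only on `U`; on `A` it may
be replaced by its indicator on `U`. -/
theorem measurable_indicator_logDeriv {f : ℂ → ℂ} {U A : Set ℂ} (hU : IsOpen U)
    (hf : ContinuousOn f U) (hA : MeasurableSet A) (hAU : A ⊆ U) :
    Measurable (A.indicator fun z => ‖deriv f z / f z‖ₑ) := by
  have h1 : Measurable (U.indicator f) := by
    classical
    rw [← Set.piecewise_eq_indicator]
    exact hf.measurable_piecewise continuousOn_const hU.measurableSet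
  have h2 : A.indicator (fun z => ‖deriv f z / f z‖ₑ) =
      A.indicator (fun z => ‖deriv f z / U.indicator f z‖ₑ) := by
    refine Set.indicator_congr fun z hz => ?_
    rw [Set.indicator_of_mem (hAU hz)]
  rw [h2]
  exact Measurable.indicator ((measurable_deriv f).div h1).enorm hA

/-- If every circle `|z| = s`, `1/4 ≤ s ≤ 1/2`, contains a point where `|f| ≤ 1`, while
`|f 0| ≥ eⁿ`, then `f' / f` has a large integral over the annulus. -/
theorem le_lintegral_annulus_logDeriv {f : ℂ → ℂ} {n : ℝ} {l : List ℂ}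
    (hf : AnalyticOnNhd ℂ f (Metric.closedBall 0 1))
    (hl : ∀ z ∈ Metric.closedBall (0 : ℂ) (3 / 4), f z = 0 → z ∈ l)
    (h0 : Real.exp n ≤ ‖f 0‖)
    (hs : ∀ s : ℝ, 1 / 4 ≤ s → s ≤ 1 / 2 → ∃ z, ‖z‖ = s ∧ ‖f z‖ ≤ 1) :
    ENNReal.ofReal (n / 4) ≤ ∫⁻ z in middleAnnulus, ‖deriv f z / f z‖ₑ := by
  have hmeas : Measurable (middleAnnulus.indicator fun z => ‖deriv f z / f z‖ₑ) := by
    refine measurable_indicator_logDeriv (U := Metric.ball 0 1) Metric.isOpen_ball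
      (hf.continuousOn.mono Metric.ball_subset_closedBall) measurableSet_middleAnnulus ?_
    intro z hz
    rw [mem_ball_zero_iff]
    linarith [hz.2]
  rw [← MeasureTheory.lintegral_indicator measurableSet_middleAnnulus,
    lintegral_eq_lintegral_polar hmeas]
  have hsub : Set.Ioo (1 / 4 : ℝ) (1 / 2) ⊆ Set.Ioi 0 := fun s hs => by
    have := hs.1
    simp only [Set.mem_Ioi]
    linarith
  refine le_trans ?_ (MeasureTheory.lintegral_mono_set hsub)
  have hconst : ENNReal.ofReal (n / 4) =
      ∫⁻ s in Set.Ioo (1 / 4 : ℝ) (1 / 2), ENNReal.ofReal n := by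
    rw [MeasureTheory.setLIntegral_const, Real.volume_Ioo, ← ENNReal.ofReal_mul' (by norm_num)]
    congr 1
    ring
  rw [hconst]
  -- Circles through a point of `l` may carry zeros of `f`; their radii form a finite, hence null,
  -- set.
  have hfin : ({s | ∃ a ∈ l, ‖a‖ = s} : Set ℝ).Finite := by
    have : ({s | ∃ a ∈ l, ‖a‖ = s} : Set ℝ) = (fun a => ‖a‖) '' {a | a ∈ l} := by
      ext s; simp
    rw [this]
    exact (List.finite_toSet l).image _
  have hae : ∀ᵐ s : ℝ, ¬ ∃ a ∈ l, ‖a‖ = s :=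
    MeasureTheory.measure_eq_zero_iff_ae_notMem.1 (hfin.measure_zero MeasureTheory.volume)
  refine MeasureTheory.lintegral_mono_ae ?_
  filter_upwards [MeasureTheory.ae_restrict_of_ae hae,
    MeasureTheory.ae_restrict_mem measurableSet_Ioo] with s hsl hs14
  obtain ⟨hs1, hs2⟩ := hs14
  have hspos : 0 < s := by linarith
  obtain ⟨z₁, hz₁, hfz₁⟩ := hs s hs1.le hs2.le
  have hcb : Metric.closedBall (0 : ℂ) s ⊆ Metric.closedBall 0 1 :=
    Metric.closedBall_subset_closedBall (by linarith)
  -- By the maximum principle the bound `eⁿ ≤ |f 0|` passes to a point of the circle.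
  obtain ⟨z₂, hz₂, hmax⟩ := Complex.exists_mem_frontier_isMaxOn_norm (f := f)
    (U := Metric.ball (0 : ℂ) s) Metric.isBounded_ball ⟨0, Metric.mem_ball_self hspos⟩
    (DifferentiableOn.diffContOnCl (by
      rw [closure_ball _ hspos.ne']; exact hf.differentiableOn.mono hcb))
  rw [frontier_ball _ hspos.ne', mem_sphere_zero_iff_norm] at hz₂
  have hmax0 : ‖f 0‖ ≤ ‖f z₂‖ := hmax (subset_closure (Metric.mem_ball_self hspos))
  have hmem : ∀ z : ℂ, ‖z‖ = s → z ∈ Metric.closedBall (0 : ℂ) (3 / 4) := by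
    intro z hz
    rw [mem_closedBall_zero_iff]; linarith
  refine (le_lintegral_circle_logDeriv (f := f) hspos
    (fun z hz => hf z (hcb (by rw [mem_closedBall_zero_iff, hz])))
    (fun z hz hfz => hsl ⟨z, hl z (hmem z hz) hfz, hz⟩) hz₁ hz₂ hfz₁ (h0.trans hmax0)).trans ?_
  gcongr with θ
  rw [Set.indicator_of_mem]
  have : ‖(s : ℂ) * Complex.exp (θ * Complex.I)‖ = s := by
    rw [norm_mul, Complex.norm_exp_ofReal_mul_I, mul_one, Complex.norm_real,
      Real.norm_of_nonneg hspos.le]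
  exact ⟨by rw [this]; exact hs1, by rw [this]; exact hs2⟩

/-! ### The majorant of the logarithmic derivative -/

/-- The logarithmic derivative is `1 / (z - a) + ā / (1 - ā z)`, and the second term is at most
`(3/4) / (17/32) < 2` because `|ā z| ≤ 15/32`. -/
theorem norm_logDeriv_blaschke_le {a z : ℂ} (ha : ‖a‖ ≤ 3 / 4) (hz : ‖z‖ ≤ 5 / 8) (hza : z ≠ a) :
    DifferentiableAt ℂ (fun z => (z - a) / (1 - (starRingEnd ℂ) a * z)) z ∧
      (z - a) / (1 - (starRingEnd ℂ) a * z) ≠ 0 ∧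
      ‖logDeriv (fun z => (z - a) / (1 - (starRingEnd ℂ) a * z)) z‖ₑ ≤ 2 + ‖z - a‖ₑ⁻¹ := by
  have h1 : ‖(starRingEnd ℂ) a * z‖ ≤ 15 / 32 := by
    rw [norm_mul, Complex.norm_conj]
    nlinarith [norm_nonneg a, norm_nonneg z]
  have h2 : 17 / 32 ≤ ‖1 - (starRingEnd ℂ) a * z‖ := by
    have := norm_sub_norm_le 1 ((starRingEnd ℂ) a * z)
    rw [norm_one] at this
    linarith
  have h3 : 1 - (starRingEnd ℂ) a * z ≠ 0 := by
    rw [← norm_pos_iff]; linarith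
  have h4 : z - a ≠ 0 := sub_ne_zero.2 hza
  refine ⟨(differentiableAt_id.sub_const a).div (by fun_prop) h3, div_ne_zero h4 h3, ?_⟩
  have h5 : logDeriv (fun z => (z - a) / (1 - (starRingEnd ℂ) a * z)) z =
      (z - a)⁻¹ + (starRingEnd ℂ) a / (1 - (starRingEnd ℂ) a * z) := by
    rw [logDeriv_div z h4 h3 (by fun_prop) (by fun_prop), logDeriv_apply, logDeriv_apply]
    have e1 : deriv (fun z => z - a) z = 1 := by simp
    have e2 : deriv (fun z => 1 - (starRingEnd ℂ) a * z) z = -(starRingEnd ℂ) a := by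
      rw [deriv_const_sub, deriv_const_mul _ differentiableAt_id]; simp
    rw [e1, e2]
    ring
  rw [h5, add_comm]
  refine (enorm_add_le _ _).trans (add_le_add ?_ ?_)
  · have : ‖(starRingEnd ℂ) a / (1 - (starRingEnd ℂ) a * z)‖ ≤ 2 := by
      rw [norm_div, Complex.norm_conj, div_le_iff₀ (by linarith)]
      linarith
    rw [← ofReal_norm]
    exact (ENNReal.ofReal_le_ofReal this).trans (by simp)
  · rw [enorm_inv h4]

/-- A majorant of `|f' / f|` for a function with zeros `l` and growth `n`. -/
noncomputable def logDerivMajorant (n : ℝ) (l : List ℂ) (z : ℂ) : ℝ≥0∞ :=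
  ENNReal.ofReal (3300 * n) + (l.map fun a => ‖z - a‖ₑ⁻¹).sum

theorem norm_logDeriv_blaschke_prod_le {z : ℂ} (hz : ‖z‖ ≤ 5 / 8) (l : List ℂ)
    (hl : ∀ a ∈ l, ‖a‖ ≤ 3 / 4) (hzl : z ∉ l) :
    DifferentiableAt ℂ
        (fun z => (l.map fun a => (z - a) / (1 - (starRingEnd ℂ) a * z)).prod) z ∧
      (l.map fun a => (z - a) / (1 - (starRingEnd ℂ) a * z)).prod ≠ 0 ∧
      ‖logDeriv (fun z => (l.map fun a => (z - a) / (1 - (starRingEnd ℂ) a * z)).prod) z‖ₑ ≤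
        2 * l.length + (l.map fun a => ‖z - a‖ₑ⁻¹).sum := by
  induction l with
  | nil => simp
  | cons a l ih =>
    obtain ⟨i1, i2, i3⟩ := ih (fun b hb => hl b (List.mem_cons_of_mem _ hb))
      (fun h => hzl (List.mem_cons_of_mem _ h))
    obtain ⟨j1, j2, j3⟩ := norm_logDeriv_blaschke_le (hl a List.mem_cons_self) hz
      (fun h => hzl (h ▸ List.mem_cons_self))
    simp only [List.map_cons, List.prod_cons, List.sum_cons, List.length_cons]
    refine ⟨j1.mul i1, mul_ne_zero j2 i2, ?_⟩
    rw [logDeriv_mul z j2 i2 j1 i1]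
    refine (enorm_add_le _ _).trans ((add_le_add j3 i3).trans (le_of_eq ?_))
    push_cast
    ring

/-- A logarithm `g` of `h` on the disc of radius `3/4` satisfies `Re (g - g 0) ≤ 9 n`.
Borel–Carathéodory gives `|g - g 0| ≤ 198 n` on radius `11/16`, and Cauchy's estimate on circles of
radius `1/16` gives `16 * 198 n = 3168 n`. -/
theorem norm_logDeriv_le_of_ne_zero {h : ℂ → ℂ} {n : ℝ} (hn : 0 < n)
    (hh : AnalyticOnNhd ℂ h (Metric.closedBall 0 1))
    (hM : ∀ z ∈ Metric.closedBall (0 : ℂ) 1, ‖h z‖ ≤ Real.exp (9 * n))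
    (hne : ∀ z ∈ Metric.closedBall (0 : ℂ) (3 / 4), h z ≠ 0) (h1 : 1 ≤ ‖h 0‖) {z : ℂ}
    (hz : ‖z‖ ≤ 5 / 8) : ‖deriv h z / h z‖ ≤ 3168 * n := by
  have hsub : Metric.ball (0 : ℂ) (3 / 4) ⊆ Metric.closedBall 0 1 :=
    (Metric.ball_subset_ball (by norm_num)).trans Metric.ball_subset_closedBall
  obtain ⟨g, hg, hexp⟩ := exists_log_on_ball (f := h) (c := 0) (R := 3 / 4) (by norm_num)
    (hh.differentiableOn.mono hsub) (fun z hz => hne z (Metric.ball_subset_closedBall hz))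
  have h0 : (0 : ℂ) ∈ Metric.ball (0 : ℂ) (3 / 4) := Metric.mem_ball_self (by norm_num)
  have hg0 : 0 ≤ (g 0).re := by
    rw [hexp 0 h0, Complex.norm_exp] at h1
    exact Real.one_le_exp_iff.1 h1
  have hbc : ∀ w : ℂ, ‖w‖ ≤ 11 / 16 → ‖g w - g 0‖ ≤ 198 * n := by
    intro w hw
    have hwb : w ∈ Metric.ball (0 : ℂ) (3 / 4) := by rw [mem_ball_zero_iff]; linarith
    have := Complex.borelCaratheodory_zero (f := fun w => g w - g 0) (M := 9 * n) (R := 3 / 4)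
      (z := w) (by positivity)
      (fun w hw => ((hg w hw).differentiableAt.sub_const _).differentiableWithinAt) ?_
      (by norm_num) hwb (sub_self _)
    · refine this.trans ?_
      rw [div_le_iff₀ (by linarith)]
      nlinarith [norm_nonneg w]
    · intro x hx
      have h2 := hM x (hsub hx)
      rw [hexp x hx, Complex.norm_exp, Real.exp_le_exp] at h2
      simp only [Set.mem_ofPred_eq, Complex.sub_re]
      linarith
  have hcz : Metric.closedBall z (1 / 16) ⊆ Metric.ball (0 : ℂ) (3 / 4) := by
    intro x hx
    rw [Metric.mem_closedBall, dist_eq_norm] at hx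
    rw [mem_ball_zero_iff]
    have := norm_add_le (x - z) z
    rw [sub_add_cancel] at this
    linarith
  have hzb : z ∈ Metric.ball (0 : ℂ) (3 / 4) := by rw [mem_ball_zero_iff]; linarith
  have hd : deriv (fun w => g w - g 0) z = deriv h z / h z := ((hg z hzb).sub_const _).deriv
  rw [← hd]
  refine (Complex.norm_deriv_le_of_forall_mem_sphere_norm_le (R := 1 / 16) (C := 198 * n)
    (by norm_num) ?_ ?_).trans (by linarith)
  · refine DifferentiableOn.diffContOnCl ?_
    rw [closure_ball _ (by norm_num)]
    exact fun w hw => ((hg w (hcz hw)).differentiableAt.sub_const _).differentiableWithinAt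
  · intro w hw
    refine hbc w ?_
    rw [mem_sphere_iff_norm] at hw
    have := norm_add_le (w - z) z
    rw [sub_add_cancel] at this
    linarith

/-- A function of growth `n` has at most `29 n` zeros in the disc, and its logarithmic derivative
is controlled by them. -/
theorem exists_zeros_logDeriv_le {f : ℂ → ℂ} {n : ℝ} (hn : 1 ≤ n)
    (hf : AnalyticOnNhd ℂ f (Metric.closedBall 0 1))
    (hM : ∀ z ∈ Metric.closedBall (0 : ℂ) 1, ‖f z‖ ≤ Real.exp (9 * n))
    (h0 : Real.exp n ≤ ‖f 0‖) :
    ∃ l : List ℂ, (l.length : ℝ) ≤ 29 * n ∧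
      (∀ z ∈ Metric.closedBall (0 : ℂ) (3 / 4), f z = 0 → z ∈ l) ∧
      (∀ z ∈ Metric.closedBall (0 : ℂ) (5 / 8), z ∉ l → f z ≠ 0) ∧
      ∀ z ∈ Metric.ball (0 : ℂ) (5 / 8), ‖deriv f z / f z‖ₑ ≤ logDerivMajorant n l z := by
  have hlog : 2 / 7 < Real.log (4 / 3) := by
    have h1 : Real.exp 2 < (4 / 3) ^ 7 := by
      have := Real.exp_one_lt_d9
      have h2 : Real.exp 2 = Real.exp 1 ^ 2 := by rw [← Real.exp_nat_mul]; norm_num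
      rw [h2]
      nlinarith [Real.exp_pos 1]
    have h3 := (Real.lt_log_iff_exp_lt (by positivity)).2 h1
    rw [Real.log_pow] at h3
    push_cast at h3
    linarith
  -- Since `28 * (2 / 7) = 8`, this many factors `4 / 3` exceed `e⁸ⁿ`, the ratio of the two bounds
  -- on `f`; the rounding costs at most `n`, as `n ≥ 1`.
  set k : ℕ := ⌈28 * n⌉₊ with hk
  have hk1 : 28 * n ≤ k := Nat.le_ceil _
  have hk2 : (k : ℝ) < 28 * n + 1 := Nat.ceil_lt_add_one (by linarith)
  have hkM : Real.exp (9 * n) < ‖f 0‖ * (4 / 3) ^ k := by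
    have h4 : Real.exp (8 * n) < (4 / 3) ^ k := by
      rw [← Real.lt_log_iff_exp_lt (by positivity), Real.log_pow]
      nlinarith
    calc Real.exp (9 * n) = Real.exp n * Real.exp (8 * n) := by rw [← Real.exp_add]; ring_nf
      _ < Real.exp n * (4 / 3) ^ k := by gcongr
      _ ≤ ‖f 0‖ * (4 / 3) ^ k := by gcongr
  obtain ⟨l, h, hlk, hla, hh, hhM, hhne, hh0, hfac⟩ := exists_blaschke_factorization k f hf hM hkM
  have hllen : (l.length : ℝ) ≤ k := by exact_mod_cast hlk
  have hfne : ∀ z ∈ Metric.closedBall (0 : ℂ) (5 / 8), z ∉ l → f z ≠ 0 := by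
    intro z hz hzl
    have hz1 : z ∈ Metric.closedBall (0 : ℂ) 1 :=
      Metric.closedBall_subset_closedBall (by norm_num) hz
    rw [hfac z hz1]
    exact mul_ne_zero (norm_logDeriv_blaschke_prod_le (mem_closedBall_zero_iff.1 hz) l hla hzl).2.1
      (hhne z (Metric.closedBall_subset_closedBall (by norm_num) hz))
  refine ⟨l, by linarith, ?_, hfne, ?_⟩
  · intro z hz hfz
    have hz1 : z ∈ Metric.closedBall (0 : ℂ) 1 :=
      Metric.closedBall_subset_closedBall (by norm_num) hz
    rw [hfac z hz1, mul_eq_zero] at hfz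
    rcases hfz with hfz | hfz
    · rw [List.prod_eq_zero_iff, List.mem_map] at hfz
      obtain ⟨a, hal, ha⟩ := hfz
      rw [div_eq_zero_iff] at ha
      rcases ha with ha | ha
      · rw [sub_eq_zero.1 ha]; exact hal
      · exfalso
        have h5 : ‖(starRingEnd ℂ) a * z‖ = 1 := by rw [← sub_eq_zero.1 ha, norm_one]
        rw [norm_mul, Complex.norm_conj] at h5
        rw [mem_closedBall_zero_iff] at hz
        nlinarith [hla a hal, norm_nonneg a, norm_nonneg z]
    · exact absurd hfz (hhne z hz)
  · intro z hz
    rw [mem_ball_zero_iff] at hz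
    by_cases hzl : z ∈ l
    · have : logDerivMajorant n l z = ⊤ := by
        unfold logDerivMajorant
        rw [ENNReal.add_eq_top]
        right
        rw [← top_le_iff]
        refine le_trans ?_ (List.single_le_sum (fun _ _ => zero_le) _
          (List.mem_map_of_mem (f := fun a => ‖z - a‖ₑ⁻¹) hzl))
        simp
      rw [this]
      exact le_top
    · have hz1 : ‖z‖ < 1 := by linarith
      obtain ⟨p1, p2, p3⟩ := norm_logDeriv_blaschke_prod_le hz.le l hla hzl
      have hev : f =ᶠ[nhds z] fun z =>
          (l.map fun a => (z - a) / (1 - (starRingEnd ℂ) a * z)).prod * h z := by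
        filter_upwards [Metric.isOpen_ball.mem_nhds (mem_ball_zero_iff.2 hz1)] with w hw
        exact hfac w (Metric.ball_subset_closedBall hw)
      have hhz : h z ≠ 0 := hhne z (by rw [mem_closedBall_zero_iff]; linarith)
      have hz1' : z ∈ Metric.closedBall (0 : ℂ) 1 := by
        rw [mem_closedBall_zero_iff]; exact hz1.le
      rw [hev.deriv_eq, hfac z hz1']
      have e := logDeriv_mul z p2 hhz p1 (hh z hz1').differentiableAt
      rw [logDeriv_apply] at e
      rw [e]
      refine (enorm_add_le _ _).trans ?_
      have hh1 : 1 ≤ ‖h 0‖ := (Real.one_le_exp (by linarith)).trans (h0.trans hh0)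
      have hb := norm_logDeriv_le_of_ne_zero (by linarith) hh hhM hhne hh1 hz.le
      have hb' : ‖logDeriv h z‖ₑ ≤ ENNReal.ofReal (3168 * n) := by
        rw [← ofReal_norm]; exact ENNReal.ofReal_le_ofReal hb
      refine (add_le_add p3 hb').trans ?_
      unfold logDerivMajorant
      have h6 : (2 * l.length : ℝ≥0∞) = ENNReal.ofReal (2 * l.length) := by
        rw [ENNReal.ofReal_mul zero_le_two]; simp
      rw [add_right_comm, h6, ← ENNReal.ofReal_add (by positivity) (by linarith)]
      -- The constant parts add up to at most `2 * 29 n + 3168 n = 3226 n`.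
      gcongr
      linarith

/-! ### Averaging and the area of the regular points -/

/-- If `E` occupies area at least `κ` in each disc of radius `δ` centred at a point of `P`, then
its area is at least `κ |P| / |ball 0 δ|`. -/
theorem mul_volume_le_of_forall_ball {E P : Set ℂ} {δ : ℝ} {κ : ℝ≥0∞} (hE : MeasurableSet E)
    (h : ∀ w ∈ P, κ ≤ MeasureTheory.volume (E ∩ Metric.ball w δ)) :
    κ * MeasureTheory.volume P ≤
      MeasureTheory.volume (Metric.ball (0 : ℂ) δ) * MeasureTheory.volume E := by
  -- Double counting: slices over `w` are bounded below by hypothesis when `w ∈ P`, slices over `z`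
  -- have at most the area of a disc.
  set T : Set (ℂ × ℂ) := {p | p.2 ∈ E ∧ dist p.2 p.1 < δ} with hT
  have hTm : MeasurableSet T :=
    (measurable_snd hE).inter
      (isOpen_lt (continuous_snd.dist continuous_fst) continuous_const).measurableSet
  have h1 := MeasureTheory.Measure.prod_apply (μ := (MeasureTheory.volume : MeasureTheory.Measure ℂ))
    (ν := (MeasureTheory.volume : MeasureTheory.Measure ℂ)) hTm
  have h2 := MeasureTheory.Measure.prod_apply_symm
    (μ := (MeasureTheory.volume : MeasureTheory.Measure ℂ))
    (ν := (MeasureTheory.volume : MeasureTheory.Measure ℂ)) hTm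
  have hm : Measurable fun w : ℂ => MeasureTheory.volume (Prod.mk w ⁻¹' T) :=
    measurable_measure_prodMk_left hTm
  calc κ * MeasureTheory.volume P = ∫⁻ _ in P, κ := (MeasureTheory.setLIntegral_const _ _).symm
    _ ≤ ∫⁻ w in P, MeasureTheory.volume (Prod.mk w ⁻¹' T) :=
        MeasureTheory.setLIntegral_mono hm fun w hw => h w hw
    _ ≤ ∫⁻ w, MeasureTheory.volume (Prod.mk w ⁻¹' T) := MeasureTheory.setLIntegral_le_lintegral _ _
    _ = ∫⁻ z, MeasureTheory.volume ((fun w => (w, z)) ⁻¹' T) := by rw [← h1, h2]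
    _ ≤ ∫⁻ z, E.indicator (fun _ => MeasureTheory.volume (Metric.ball (0 : ℂ) δ)) z := by
        refine MeasureTheory.lintegral_mono fun z => ?_
        by_cases hz : z ∈ E
        · rw [Set.indicator_of_mem hz]
          have : (fun w => (w, z)) ⁻¹' T ⊆ Metric.ball z δ := by
            rintro w ⟨_, hw⟩
            rw [Metric.mem_ball, dist_comm]
            exact hw
          exact (MeasureTheory.measure_mono this).trans
            (by rw [Complex.volume_ball, Complex.volume_ball])
        · rw [Set.indicator_of_notMem hz]
          have : (fun w => (w, z)) ⁻¹' T = ∅ := by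
            ext w
            simp only [Set.mem_preimage, Set.mem_empty_iff_false, iff_false]
            exact fun hw => hz hw.1
          rw [this, MeasureTheory.measure_empty]
    _ = _ := by
        rw [MeasureTheory.lintegral_indicator hE, MeasureTheory.setLIntegral_const]

theorem measurable_logDerivMajorant (n : ℝ) (l : List ℂ) : Measurable (logDerivMajorant n l) := by
  have : Measurable fun z : ℂ => (l.map fun a => ‖z - a‖ₑ⁻¹).sum := by
    induction l with
    | nil => exact measurable_const
    | cons a l ih =>
      simp only [List.map_cons, List.sum_cons]
      exact Measurable.add (by fun_prop) ih
  exact measurable_const.add this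

/-- The radius `s` is left free: `s = 1` bounds the total integral over the annulus, and a small `s`
shows that sets of small area carry little of it. -/
theorem setLIntegral_logDerivMajorant_le {s : ℝ} (hs : 0 < s) (n : ℝ) (l : List ℂ) (Q : Set ℂ) :
    ∫⁻ z in Q, logDerivMajorant n l z ≤
      ENNReal.ofReal (3300 * n) * MeasureTheory.volume Q +
        l.length * (ENNReal.ofReal (2 * Real.pi * s) +
          ENNReal.ofReal s⁻¹ * MeasureTheory.volume Q) := by
  unfold logDerivMajorant
  rw [MeasureTheory.lintegral_add_left measurable_const, MeasureTheory.setLIntegral_const]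
  gcongr
  induction l with
  | nil => simp
  | cons a l ih =>
    simp only [List.map_cons, List.sum_cons, List.length_cons]
    rw [MeasureTheory.lintegral_add_left (by fun_prop)]
    push_cast
    rw [add_mul, one_mul, add_comm]
    gcongr
    exact setLIntegral_inv_norm_le hs a Q

theorem volume_middleAnnulus_le : MeasureTheory.volume middleAnnulus ≤ 1 := by
  have hsub : middleAnnulus ⊆ Metric.ball (0 : ℂ) (1 / 2) := fun z hz => by
    rw [mem_ball_zero_iff]; exact hz.2
  refine (MeasureTheory.measure_mono hsub).trans ?_
  rw [Complex.volume_ball, ← ENNReal.ofReal_pow (by norm_num), ← ENNReal.ofReal_coe_nnreal,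
    ← ENNReal.ofReal_mul (by norm_num), ← ENNReal.ofReal_one]
  refine ENNReal.ofReal_le_ofReal ?_
  have := Real.pi_lt_four
  rw [NNReal.coe_real_pi]
  linarith

/-- The points of the annulus where `f' / f` has size about `n` and no zero of `f` is close. -/
def regularPoints (f : ℂ → ℂ) (n δ : ℝ) (l : List ℂ) : Set ℂ :=
  {w | w ∈ middleAnnulus ∧ ENNReal.ofReal (n / 8) ≤ ‖deriv f w / f w‖ₑ ∧
    logDerivMajorant n l w < ENNReal.ofReal (10 ^ 11 * n) ∧ ∀ a ∈ l, 2 * δ ≤ ‖w - a‖}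

theorem volume_biUnion_ball_le {l : List ℂ} {r : ℝ} :
    MeasureTheory.volume (⋃ a ∈ l, Metric.ball a r) ≤
      l.length * MeasureTheory.volume (Metric.ball (0 : ℂ) r) := by
  induction l with
  | nil => simp
  | cons a l ih =>
    have : (⋃ b ∈ a :: l, Metric.ball b r) = Metric.ball a r ∪ ⋃ b ∈ l, Metric.ball b r := by
      ext z; simp
    rw [this]
    refine (MeasureTheory.measure_union_le _ _).trans ?_
    rw [List.length_cons]
    push_cast
    rw [add_mul, one_mul, add_comm]
    refine add_le_add ih (le_of_eq ?_)
    rw [Complex.volume_ball, Complex.volume_ball]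

/-- Of the integral `n / 4`, points with `|f' / f| < n / 8` carry at most `n / 8`. Points where the
majorant is large (`Q₁`, by Markov) or which are close to `l` (`Q₂`, by a union bound) have total
area at most `10⁻⁷` and carry at most `n / 16`. The remaining `n / 16` sits where `|f' / f| ≤ 10¹¹
n`, which forces the area. -/
theorem le_volume_regularPoints {f : ℂ → ℂ} {n δ : ℝ} {l : List ℂ} (hn : 0 < n)
    (hδ : 0 ≤ δ) (hδn : 29 * n * (16 * δ ^ 2) ≤ 5 / 10 ^ 8)
    (hlen : (l.length : ℝ) ≤ 29 * n)
    (hup : ∀ z ∈ Metric.ball (0 : ℂ) (5 / 8), ‖deriv f z / f z‖ₑ ≤ logDerivMajorant n l z)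
    (hint : ENNReal.ofReal (n / 4) ≤ ∫⁻ z in middleAnnulus, ‖deriv f z / f z‖ₑ) :
    ENNReal.ofReal (1 / (16 * 10 ^ 11)) ≤ MeasureTheory.volume (regularPoints f n δ l) := by
  have hpi := Real.pi_pos
  have hpi4 := Real.pi_lt_d2
  have hlen' : (l.length : ℝ≥0∞) ≤ ENNReal.ofReal (29 * n) := by
    rw [← ENNReal.ofReal_natCast]; exact ENNReal.ofReal_le_ofReal hlen
  set A₁ : Set ℂ := {w | w ∈ middleAnnulus ∧ ‖deriv f w / f w‖ₑ < ENNReal.ofReal (n / 8)} with hA₁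
  set Q₁ : Set ℂ := {w | w ∈ middleAnnulus ∧
    ENNReal.ofReal (10 ^ 11 * n) ≤ logDerivMajorant n l w} with hQ₁
  set Q₂ : Set ℂ := middleAnnulus ∩ ⋃ a ∈ l, Metric.ball a (2 * δ) with hQ₂
  set P := regularPoints f n δ l with hP
  have hcover : middleAnnulus ⊆ A₁ ∪ ((Q₁ ∪ Q₂) ∪ P) := by
    intro w hw
    by_cases h1 : ‖deriv f w / f w‖ₑ < ENNReal.ofReal (n / 8)
    · exact Or.inl ⟨hw, h1⟩
    by_cases h2 : ENNReal.ofReal (10 ^ 11 * n) ≤ logDerivMajorant n l w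
    · exact Or.inr (Or.inl (Or.inl ⟨hw, h2⟩))
    by_cases h3 : ∀ a ∈ l, 2 * δ ≤ ‖w - a‖
    · exact Or.inr (Or.inr ⟨hw, not_lt.1 h1, not_le.1 h2, h3⟩)
    · push Not at h3
      obtain ⟨a, ha, haw⟩ := h3
      refine Or.inr (Or.inl (Or.inr ⟨hw, ?_⟩))
      simp only [Set.mem_iUnion]
      exact ⟨a, ha, by rwa [Metric.mem_ball, dist_eq_norm]⟩
  have hann : ∀ w ∈ middleAnnulus, w ∈ Metric.ball (0 : ℂ) (5 / 8) := fun w hw => by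
    rw [mem_ball_zero_iff]; linarith [hw.2]
  have hQann : ∀ w ∈ Q₁ ∪ Q₂, w ∈ middleAnnulus := by
    rintro w (hw | hw)
    · exact hw.1
    · exact hw.1
  have hintH : ∫⁻ z in middleAnnulus, logDerivMajorant n l z ≤ ENNReal.ofReal (3600 * n) := by
    refine (setLIntegral_logDerivMajorant_le one_pos n l _).trans ?_
    have hv := volume_middleAnnulus_le
    calc ENNReal.ofReal (3300 * n) * MeasureTheory.volume middleAnnulus +
          l.length * (ENNReal.ofReal (2 * Real.pi * 1) +
            ENNReal.ofReal 1⁻¹ * MeasureTheory.volume middleAnnulus)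
        ≤ ENNReal.ofReal (3300 * n) * 1 + ENNReal.ofReal (29 * n) *
          (ENNReal.ofReal (2 * Real.pi * 1) + ENNReal.ofReal 1⁻¹ * 1) := by gcongr
      _ = ENNReal.ofReal (3300 * n + 29 * n * (2 * Real.pi * 1 + 1⁻¹)) := by
          rw [mul_one (ENNReal.ofReal (3300 * n)), mul_one (ENNReal.ofReal 1⁻¹),
            ← ENNReal.ofReal_add (by positivity) (by positivity),
            ← ENNReal.ofReal_mul (by positivity), ← ENNReal.ofReal_add (by positivity)
            (by positivity)]
      _ ≤ ENNReal.ofReal (3600 * n) := ENNReal.ofReal_le_ofReal (by nlinarith)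
  have hvQ₁ : MeasureTheory.volume Q₁ ≤ ENNReal.ofReal (5 / 10 ^ 8) := by
    have hmk := MeasureTheory.mul_meas_ge_le_lintegral₀
      (μ := MeasureTheory.volume.restrict middleAnnulus)
      (measurable_logDerivMajorant n l).aemeasurable (ENNReal.ofReal (10 ^ 11 * n))
    have hset : MeasurableSet {x | ENNReal.ofReal (10 ^ 11 * n) ≤ logDerivMajorant n l x} :=
      measurableSet_le measurable_const (measurable_logDerivMajorant n l)
    rw [MeasureTheory.Measure.restrict_apply hset] at hmk
    have hQeq : {x | ENNReal.ofReal (10 ^ 11 * n) ≤ logDerivMajorant n l x} ∩ middleAnnulus = Q₁ := by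
      ext w; exact and_comm
    rw [hQeq] at hmk
    have hpos : ENNReal.ofReal (10 ^ 11 * n) ≠ 0 := (ENNReal.ofReal_pos.2 (by positivity)).ne'
    rw [← ENNReal.mul_le_mul_iff_right hpos ENNReal.ofReal_ne_top,
      ← ENNReal.ofReal_mul (by positivity)]
    exact hmk.trans (hintH.trans (ENNReal.ofReal_le_ofReal (by linarith)))
  have hvQ₂ : MeasureTheory.volume Q₂ ≤ ENNReal.ofReal (5 / 10 ^ 8) := by
    refine (MeasureTheory.measure_mono Set.inter_subset_right).trans
      (volume_biUnion_ball_le.trans ?_)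
    rw [Complex.volume_ball, ← ENNReal.ofReal_pow (by linarith), ← ENNReal.ofReal_coe_nnreal,
      ← ENNReal.ofReal_mul (by positivity), NNReal.coe_real_pi]
    calc (l.length : ℝ≥0∞) * ENNReal.ofReal ((2 * δ) ^ 2 * Real.pi)
        ≤ ENNReal.ofReal (29 * n) * ENNReal.ofReal ((2 * δ) ^ 2 * Real.pi) := by gcongr
      _ = ENNReal.ofReal (29 * n * ((2 * δ) ^ 2 * Real.pi)) := by
          rw [← ENNReal.ofReal_mul (by positivity)]
      _ ≤ _ := by
          refine ENNReal.ofReal_le_ofReal (le_trans ?_ hδn)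
          gcongr 29 * n * ?_
          nlinarith [sq_nonneg δ, Real.pi_lt_four]
  have hvQ : MeasureTheory.volume (Q₁ ∪ Q₂) ≤ ENNReal.ofReal (1 / 10 ^ 7) := by
    refine (MeasureTheory.measure_union_le _ _).trans ((add_le_add hvQ₁ hvQ₂).trans ?_)
    rw [← ENNReal.ofReal_add (by norm_num) (by norm_num)]
    exact ENNReal.ofReal_le_ofReal (by norm_num)
  have hintQ : ∫⁻ z in Q₁ ∪ Q₂, ‖deriv f z / f z‖ₑ ≤ ENNReal.ofReal (n / 16) := by
    refine (MeasureTheory.setLIntegral_mono (measurable_logDerivMajorant n l)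
      fun z hz => hup z (hann z (hQann z hz))).trans ?_
    -- For this `s` and area `10⁻⁷`, both `2πs` and `|Q| / s` are at most `10⁻³`, small enough to
    -- survive the factor `29 n`.
    refine (setLIntegral_logDerivMajorant_le (s := 1 / 10000) (by norm_num) n l _).trans ?_
    calc ENNReal.ofReal (3300 * n) * MeasureTheory.volume (Q₁ ∪ Q₂) +
          l.length * (ENNReal.ofReal (2 * Real.pi * (1 / 10000)) +
            ENNReal.ofReal (1 / 10000)⁻¹ * MeasureTheory.volume (Q₁ ∪ Q₂))
        ≤ ENNReal.ofReal (3300 * n) * ENNReal.ofReal (1 / 10 ^ 7) + ENNReal.ofReal (29 * n) *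
          (ENNReal.ofReal (2 * Real.pi * (1 / 10000)) +
            ENNReal.ofReal (1 / 10000)⁻¹ * ENNReal.ofReal (1 / 10 ^ 7)) := by gcongr
      _ = ENNReal.ofReal (3300 * n * (1 / 10 ^ 7) + 29 * n *
            (2 * Real.pi * (1 / 10000) + (1 / 10000)⁻¹ * (1 / 10 ^ 7))) := by
          rw [← ENNReal.ofReal_mul (by positivity), ← ENNReal.ofReal_mul (by positivity),
            ← ENNReal.ofReal_add (by positivity) (by positivity),
            ← ENNReal.ofReal_mul (by positivity), ← ENNReal.ofReal_add (by positivity)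
            (by positivity)]
      _ ≤ ENNReal.ofReal (n / 16) := ENNReal.ofReal_le_ofReal (by nlinarith)
  have hintA : ∫⁻ z in A₁, ‖deriv f z / f z‖ₑ ≤ ENNReal.ofReal (n / 8) := by
    refine (MeasureTheory.setLIntegral_mono measurable_const fun z hz => hz.2.le).trans ?_
    rw [MeasureTheory.setLIntegral_const]
    refine (mul_le_mul_right ((MeasureTheory.measure_mono fun z hz => hz.1).trans
      volume_middleAnnulus_le) _).trans (by rw [mul_one])
  have hintP : ∫⁻ z in P, ‖deriv f z / f z‖ₑ ≤
      ENNReal.ofReal (10 ^ 11 * n) * MeasureTheory.volume P := by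
    rw [← MeasureTheory.setLIntegral_const]
    exact MeasureTheory.setLIntegral_mono measurable_const
      fun z hz => (hup z (hann z hz.1)).trans hz.2.2.1.le
  have hfinal : ENNReal.ofReal (n / 4) ≤ ENNReal.ofReal (3 * n / 16) +
      ENNReal.ofReal (10 ^ 11 * n) * MeasureTheory.volume P := by
    refine hint.trans ((MeasureTheory.lintegral_mono_set hcover).trans ?_)
    refine (MeasureTheory.lintegral_union_le _ _ _).trans ?_
    refine (add_le_add hintA ((MeasureTheory.lintegral_union_le _ _ _).trans
      (add_le_add hintQ hintP))).trans (le_of_eq ?_)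
    rw [← add_assoc, ← ENNReal.ofReal_add (by positivity) (by positivity)]
    congr 2
    ring
  have hpos : ENNReal.ofReal (10 ^ 11 * n) ≠ 0 := (ENNReal.ofReal_pos.2 (by positivity)).ne'
  rw [← ENNReal.mul_le_mul_iff_right hpos ENNReal.ofReal_ne_top,
    ← ENNReal.ofReal_mul (by positivity)]
  have h3 : ENNReal.ofReal (3 * n / 16) ≠ ⊤ := ENNReal.ofReal_ne_top
  rw [← ENNReal.add_le_add_iff_left h3]
  refine le_trans (le_of_eq ?_) hfinal
  rw [← ENNReal.ofReal_add (by positivity) (by positivity)]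
  congr 1
  ring

/-- A move by `δ` from a point at distance at least `2 δ` from `a` at most halves that distance, so
a bound at `w` extends to the whole disc about `w`. -/
theorem logDerivMajorant_le_two_mul {n δ : ℝ} {l : List ℂ} {w z : ℂ}
    (hl : ∀ a ∈ l, 2 * δ ≤ ‖w - a‖) (hz : ‖z - w‖ ≤ δ) :
    logDerivMajorant n l z ≤ 2 * logDerivMajorant n l w := by
  unfold logDerivMajorant
  rw [mul_add]
  refine add_le_add ?_ ?_
  · exact le_mul_of_one_le_left zero_le one_le_two
  · induction l with
    | nil => simp
    | cons a l ih =>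
      simp only [List.map_cons, List.sum_cons]
      rw [mul_add]
      refine add_le_add ?_ (ih fun b hb => hl b (List.mem_cons_of_mem _ hb))
      have ha := hl a List.mem_cons_self
      have h1 : ‖w - a‖ ≤ 2 * ‖z - a‖ := by
        have := norm_sub_le (z - a) (z - w)
        rw [sub_sub_sub_cancel_left] at this
        linarith
      have h2 : ‖w - a‖ₑ ≤ 2 * ‖z - a‖ₑ := by
        rw [← ofReal_norm, ← ofReal_norm, ← ENNReal.ofReal_ofNat 2, ← ENNReal.ofReal_mul zero_le_two]
        exact ENNReal.ofReal_le_ofReal h1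
      have h3 := ENNReal.inv_le_inv.2 h2
      rw [ENNReal.mul_inv (Or.inl two_ne_zero) (Or.inl ENNReal.ofNat_ne_top)] at h3
      calc ‖z - a‖ₑ⁻¹ = 2 * (2⁻¹ * ‖z - a‖ₑ⁻¹) := by
            rw [← mul_assoc, ENNReal.mul_inv_cancel two_ne_zero ENNReal.ofNat_ne_top, one_mul]
        _ ≤ 2 * ‖w - a‖ₑ⁻¹ := by gcongr

/-! ### Area estimate for functions of large growth -/

/-- A function of large growth `n` at the centre of the unit disc, which is at most `1` in
modulus somewhere on each circle `|z| = s`, takes values in a sector of opening `α` on a set of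
area at least `c α`. -/
theorem exists_le_volume_preimage_sector_of_growth :
    ∃ c N₀ : ℝ, 0 < c ∧ 1 ≤ N₀ ∧ ∀ (f : ℂ → ℂ) (n : ℝ), N₀ ≤ n →
      AnalyticOnNhd ℂ f (Metric.closedBall 0 1) →
      (∀ z ∈ Metric.closedBall (0 : ℂ) 1, ‖f z‖ ≤ Real.exp (9 * n)) → Real.exp n ≤ ‖f 0‖ →
      (∀ s : ℝ, 1 / 4 ≤ s → s ≤ 1 / 2 → ∃ z, ‖z‖ = s ∧ ‖f z‖ ≤ 1) →
      ∀ θ₁ θ₂ : ℝ, 0 ≤ θ₂ - θ₁ → θ₂ - θ₁ ≤ 2 * Real.pi →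
        ENNReal.ofReal (c * (θ₂ - θ₁)) ≤
          MeasureTheory.volume (f ⁻¹' sector θ₁ θ₂ ∩ Metric.ball 0 1) := by
  -- Twice the bound `10 ^ 11` in `regularPoints`, the factor `2` being lost between the centre and
  -- the disc.
  set L : ℝ := 2 * 10 ^ 11 with hL
  set B : ℝ := (L * (81920 * L)) ^ 2 * Real.pi with hB
  have hpi := Real.pi_pos
  have hBpos : 0 < B := by positivity
  -- `B = (L n)² * (δ² π)`, in which `n` cancels. The threshold `10 ^ 43` ensures `δ ≤ 1 / 16` and
  -- that the discs about the zeros have small total area.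
  refine ⟨1 / (16 * 10 ^ 11) / B, 10 ^ 43, by positivity, by norm_num, ?_⟩
  intro f n hn hf hM h0 hs θ₁ θ₂ hθ0 hθ
  have hn1 : 1 ≤ n := le_trans (by norm_num) hn
  have hn0 : 0 < n := by linarith
  set δ : ℝ := 81920 * L / n with hδ
  have hδ0 : 0 < δ := by positivity
  have hδ16 : δ ≤ 1 / 16 := by
    rw [hδ, div_le_iff₀ hn0, hL]
    linarith
  obtain ⟨l, hlen, hl1, hl2, hup⟩ := exists_zeros_logDeriv_le hn1 hf hM h0
  have hint := le_lintegral_annulus_logDeriv hf hl1 h0 hs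
  have hvol := le_volume_regularPoints (δ := δ) hn0 hδ0.le (by
    have : 29 * n * (16 * δ ^ 2) = 29 * 16 * (81920 * L) ^ 2 / n := by
      rw [hδ]; field_simp
    rw [this, div_le_iff₀ hn0, hL]
    linarith) hlen hup hint
  set E : Set ℂ := f ⁻¹' sector θ₁ θ₂ ∩ Metric.ball 0 1 with hE
  have hEm : MeasurableSet E := by
    have := (hf.continuousOn.mono Metric.ball_subset_closedBall).isOpen_inter_preimage
      Metric.isOpen_ball (isOpen_sector θ₁ θ₂)
    rw [Set.inter_comm] at this
    exact this.measurableSet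
  have hloc : ∀ w ∈ regularPoints f n δ l, ENNReal.ofReal ((θ₂ - θ₁) / (L * n) ^ 2) ≤
      MeasureTheory.volume (E ∩ Metric.ball w δ) := by
    rintro w ⟨hw1, hw2, hw3, hw4⟩
    have hwn : ‖w‖ < 1 / 2 := hw1.2
    have hsub : ∀ z ∈ Metric.ball w δ, z ∈ Metric.ball (0 : ℂ) (5 / 8) := by
      intro z hz
      rw [Metric.mem_ball, dist_eq_norm] at hz
      rw [mem_ball_zero_iff]
      have := norm_add_le (z - w) w
      rw [sub_add_cancel] at this
      linarith
    have hne : ∀ z ∈ Metric.ball w δ, f z ≠ 0 := by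
      intro z hz
      refine hl2 z (Metric.ball_subset_closedBall (hsub z hz)) fun hzl => ?_
      have h1 := hw4 z hzl
      rw [Metric.mem_ball, dist_eq_norm, norm_sub_rev] at hz
      linarith
    have hFup : ∀ z ∈ Metric.ball w δ, ‖deriv f z / f z‖ ≤ L * n := by
      intro z hz
      have hz' : ‖z - w‖ ≤ δ := by
        rw [← dist_eq_norm]; exact (Metric.mem_ball.1 hz).le
      have h1 := (hup z (hsub z hz)).trans (logDerivMajorant_le_two_mul hw4 hz')
      have h2 : 2 * logDerivMajorant n l w ≤ 2 * ENNReal.ofReal (10 ^ 11 * n) := by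
        gcongr
      have h3 := h1.trans h2
      rw [← ENNReal.ofReal_ofNat 2, ← ENNReal.ofReal_mul zero_le_two, ← ofReal_norm,
        ENNReal.ofReal_le_ofReal_iff (by positivity)] at h3
      rw [hL]
      linarith
    have hlow : n / 8 ≤ ‖deriv f w / f w‖ := by
      rw [← ofReal_norm] at hw2
      exact (ENNReal.ofReal_le_ofReal_iff (norm_nonneg _)).1 hw2
    have hsub1 : Metric.ball w δ ⊆ Metric.closedBall (0 : ℂ) 1 := fun z hz => by
      have := hsub z hz
      rw [mem_ball_zero_iff] at this
      rw [mem_closedBall_zero_iff]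
      linarith
    have key := le_volume_preimage_sector_of_logDeriv (θ₁ := θ₁) (θ₂ := θ₂) hn0
      (by rw [hL]; norm_num : (1 : ℝ) ≤ L) (hf.differentiableOn.mono hsub1) hne hFup hlow hθ
    have hEb : f ⁻¹' sector θ₁ θ₂ ∩ Metric.ball w δ ⊆ E ∩ Metric.ball w δ := by
      rintro z ⟨hz1, hz2⟩
      refine ⟨⟨hz1, ?_⟩, hz2⟩
      have := hsub z hz2
      rw [mem_ball_zero_iff] at this ⊢
      linarith
    have hpos : ENNReal.ofReal ((L * n) ^ 2) ≠ 0 := (ENNReal.ofReal_pos.2 (by positivity)).ne'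
    rw [← ENNReal.mul_le_mul_iff_right hpos ENNReal.ofReal_ne_top,
      ← ENNReal.ofReal_mul (by positivity), mul_div_cancel₀ _ (by positivity)]
    exact key.trans (by gcongr)
  have hmul := mul_volume_le_of_forall_ball hEm hloc
  have h1 : ENNReal.ofReal ((θ₂ - θ₁) / (L * n) ^ 2) * ENNReal.ofReal (1 / (16 * 10 ^ 11)) ≤
      ENNReal.ofReal (δ ^ 2 * Real.pi) * MeasureTheory.volume E := by
    refine (mul_le_mul_right hvol _).trans (hmul.trans (le_of_eq ?_))
    rw [Complex.volume_ball, ← ENNReal.ofReal_pow hδ0.le, ← ENNReal.ofReal_coe_nnreal,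
      ← ENNReal.ofReal_mul (by positivity), NNReal.coe_real_pi]
  have hpos : ENNReal.ofReal (δ ^ 2 * Real.pi) ≠ 0 := (ENNReal.ofReal_pos.2 (by positivity)).ne'
  rw [← ENNReal.mul_le_mul_iff_right hpos ENNReal.ofReal_ne_top]
  refine le_trans (le_of_eq ?_) h1
  rw [← ENNReal.ofReal_mul (by positivity), ← ENNReal.ofReal_mul (by positivity)]
  congr 1
  rw [hB, hδ]
  field_simp

/-- Rescaling to `ζ ↦ A⁻¹ f (y + η ζ)`: division by `A > 0` preserves sectors, and the affine map
multiplies areas by `η²`. -/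
theorem exists_le_volume_preimage_sector_of_growth_ball :
    ∃ c N₀ : ℝ, 0 < c ∧ 1 ≤ N₀ ∧ ∀ (f : ℂ → ℂ) (y : ℂ) (η n A : ℝ), 0 < η → 0 < A → N₀ ≤ n →
      AnalyticOnNhd ℂ f (Metric.closedBall y η) →
      (∀ z ∈ Metric.closedBall y η, ‖f z‖ ≤ A * Real.exp (9 * n)) → A * Real.exp n ≤ ‖f y‖ →
      (∀ s : ℝ, 1 / 4 ≤ s → s ≤ 1 / 2 → ∃ z, ‖z - y‖ = s * η ∧ ‖f z‖ ≤ A) →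
      ∀ θ₁ θ₂ : ℝ, 0 ≤ θ₂ - θ₁ → θ₂ - θ₁ ≤ 2 * Real.pi →
        ENNReal.ofReal (c * η ^ 2 * (θ₂ - θ₁)) ≤
          MeasureTheory.volume (f ⁻¹' sector θ₁ θ₂ ∩ Metric.ball y η) := by
  obtain ⟨c, N₀, hc, hN, H⟩ := exists_le_volume_preimage_sector_of_growth
  refine ⟨c, N₀, hc, hN, ?_⟩
  intro f y η n A hη hA hn hf hM hy hs θ₁ θ₂ hθ0 hθ
  set G : ℂ → ℂ := fun ζ => y + η * ζ with hG
  have hη' : (η : ℂ) ≠ 0 := by exact_mod_cast hη.ne'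
  have hGd : ∀ ζ, ‖G ζ - y‖ = η * ‖ζ‖ := by
    intro ζ
    simp only [hG]
    rw [add_sub_cancel_left, norm_mul, Complex.norm_real, Real.norm_of_nonneg hη.le]
  have hGmem : ∀ ζ ∈ Metric.closedBall (0 : ℂ) 1, G ζ ∈ Metric.closedBall y η := by
    intro ζ hζ
    rw [mem_closedBall_zero_iff] at hζ
    rw [Metric.mem_closedBall, dist_eq_norm, hGd]
    nlinarith
  set f₁ : ℂ → ℂ := fun ζ => ((A⁻¹ : ℝ) : ℂ) * f (G ζ) with hf₁
  have hnorm : ∀ ζ, ‖f₁ ζ‖ = ‖f (G ζ)‖ / A := by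
    intro ζ
    simp only [hf₁]
    rw [norm_mul, Complex.norm_real, Real.norm_of_nonneg (by positivity), div_eq_inv_mul]
  have han : AnalyticOnNhd ℂ f₁ (Metric.closedBall 0 1) := by
    intro ζ hζ
    refine analyticAt_const.mul ?_
    exact AnalyticAt.comp (g := f) (f := G) (hf _ (hGmem ζ hζ))
      (analyticAt_const.add (analyticAt_const.mul analyticAt_id))
  have hG0 : G 0 = y := by simp [hG]
  have key := H f₁ n hn han ?_ ?_ ?_ θ₁ θ₂ hθ0 hθ
  · set E : Set ℂ := f₁ ⁻¹' sector θ₁ θ₂ ∩ Metric.ball 0 1 with hE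
    have hEm : MeasurableSet E := by
      have := (han.continuousOn.mono Metric.ball_subset_closedBall).isOpen_inter_preimage
        Metric.isOpen_ball (isOpen_sector θ₁ θ₂)
      rw [Set.inter_comm] at this
      exact this.measurableSet
    have himg : G '' E ⊆ f ⁻¹' sector θ₁ θ₂ ∩ Metric.ball y η := by
      rintro _ ⟨ζ, ⟨h1, h2⟩, rfl⟩
      refine ⟨(mul_mem_sector (inv_pos.2 hA)).1 h1, ?_⟩
      rw [mem_ball_zero_iff] at h2
      rw [Metric.mem_ball, dist_eq_norm, hGd]
      nlinarith
    have hvol := le_volume_image_of_le_norm_deriv (G := G) (G' := fun _ => (η : ℂ)) (B := η) hEm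
      (fun z _ => (((hasDerivAt_id z).const_mul (η : ℂ)).const_add y).congr_deriv (mul_one _))
      (fun a _ b _ h => by
        simpa [hG, hη'] using h) hη.le
      (fun z _ => by rw [Complex.norm_real, Real.norm_of_nonneg hη.le])
    refine le_trans ?_ (hvol.trans (MeasureTheory.measure_mono himg))
    calc ENNReal.ofReal (c * η ^ 2 * (θ₂ - θ₁)) =
          ENNReal.ofReal (η ^ 2) * ENNReal.ofReal (c * (θ₂ - θ₁)) := by
          rw [← ENNReal.ofReal_mul (by positivity)]; congr 1; ring
      _ ≤ _ := by gcongr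
  · intro ζ hζ
    rw [hnorm, div_le_iff₀ hA, mul_comm]
    exact hM _ (hGmem ζ hζ)
  · rw [hnorm, hG0, le_div_iff₀ hA, mul_comm]
    exact hy
  · intro s hs1 hs2
    obtain ⟨z, hz, hfz⟩ := hs s hs1 hs2
    have hGz : G ((z - y) / η) = z := by
      simp only [hG]
      rw [mul_div_cancel₀ _ hη', add_sub_cancel]
    refine ⟨(z - y) / η, ?_, ?_⟩
    · rw [norm_div, Complex.norm_real, Real.norm_of_nonneg hη.le, hz, mul_div_cancel_right₀ _ hη.ne']
    · rw [hnorm, hGz, div_le_one hA]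
      exact hfz

/-! ### Area estimate under bounded doubling -/

/-- A holomorphic function vanishing at the origin, whose modulus on a smaller disc is comparable
to its modulus on a larger one, covers a disc of comparable radius around the origin. -/
theorem ball_subset_image_of_doubling {f : ℂ → ℂ} {r M K : ℝ} (hr : 0 < r) (hM : 0 < M)
    (hK : 0 ≤ K) (hf : DifferentiableOn ℂ f (Metric.ball 0 r)) (hf0 : f 0 = 0)
    (hfM : ∀ z ∈ Metric.ball (0 : ℂ) r, ‖f z‖ ≤ M) {z₀ : ℂ} (hz₀ : ‖z₀‖ ≤ r / 4)
    (hfz₀ : M * Real.exp (-K) ≤ ‖f z₀‖) :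
    Metric.ball 0 (M * Real.exp (-(3 * K + 6))) ⊆ f '' Metric.ball 0 (3 * r / 4) := by
  intro w hw
  rw [mem_ball_zero_iff] at hw
  by_contra hne
  have hsub : Metric.ball z₀ (r / 2) ⊆ Metric.ball 0 (3 * r / 4) := by
    intro z hz
    rw [Metric.mem_ball, dist_eq_norm] at hz
    rw [mem_ball_zero_iff]
    have := norm_add_le (z - z₀) z₀
    rw [sub_add_cancel] at this
    linarith
  have hsub' : Metric.ball z₀ (r / 2) ⊆ Metric.ball 0 r :=
    hsub.trans (Metric.ball_subset_ball (by linarith))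
  have hlog2 : Real.log 2 ≤ 1 := by
    have := Real.log_le_sub_one_of_pos (x := 2) two_pos
    linarith
  have hK1 : Real.exp (-(3 * K + 6)) ≤ Real.exp (-K) / 2 := by
    rw [le_div_iff₀ two_pos, ← Real.exp_log two_pos, ← Real.exp_add]
    exact Real.exp_le_exp.2 (by linarith)
  have hwM : ‖w‖ ≤ M * Real.exp (-K) / 2 := by
    have := mul_le_mul_of_nonneg_left hK1 hM.le
    linarith
  have hwM' : ‖w‖ ≤ M := by
    have : Real.exp (-K) ≤ 1 := Real.exp_le_one_iff.2 (by linarith)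
    nlinarith [Real.exp_pos (-K)]
  -- If `w` is omitted, `f - w` has a logarithm `g` near `z₀` with `Re g ≤ log M + 1` and `Re (g z₀)
  -- ≥ log M - K - 1`. Borel–Carathéodory centred at `z₀` then gives `Re (g 0) ≥ log M - 3K - 5`,
  -- too large for `|f 0 - w| = |w|`.
  obtain ⟨g, hg, hexp⟩ := exists_log_on_ball (f := fun z => f z - w) (c := z₀) (R := r / 2)
    (by positivity) ((hf.mono hsub').sub_const w)
    (fun z hz h => hne ⟨z, hsub hz, sub_eq_zero.1 h⟩)
  have hz₀b : z₀ ∈ Metric.ball z₀ (r / 2) := Metric.mem_ball_self (by positivity)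
  have h0b : (0 : ℂ) ∈ Metric.ball z₀ (r / 2) := by
    rw [Metric.mem_ball, dist_eq_norm, zero_sub, norm_neg]; linarith
  have hgz₀ : Real.log M - K - 1 ≤ (g z₀).re := by
    have h1 : M * Real.exp (-K) / 2 ≤ Real.exp (g z₀).re := by
      rw [← Complex.norm_exp, ← hexp z₀ hz₀b]
      have := norm_sub_norm_le (f z₀) w
      linarith
    have h2 := Real.log_le_log (by positivity) h1
    rw [Real.log_exp, Real.log_div (by positivity) (by norm_num), Real.log_mul hM.ne'
      (Real.exp_pos _).ne', Real.log_exp] at h2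
    linarith
  have hg0 : (g 0).re < Real.log M - (3 * K + 6) := by
    have h1 : Real.exp (g 0).re < M * Real.exp (-(3 * K + 6)) := by
      rw [← Complex.norm_exp, ← hexp 0 h0b, hf0, zero_sub, norm_neg]
      exact hw
    have h2 := Real.log_lt_log (Real.exp_pos _) h1
    rw [Real.log_exp, Real.log_mul hM.ne' (Real.exp_pos _).ne', Real.log_exp] at h2
    linarith
  have hgup : ∀ z ∈ Metric.ball z₀ (r / 2), (g z).re ≤ Real.log M + 1 := by
    intro z hz
    have h1 : Real.exp (g z).re ≤ M * 2 := by
      rw [← Complex.norm_exp, ← hexp z hz]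
      have := norm_sub_le (f z) w
      have := hfM z (hsub' hz)
      linarith
    have h2 := Real.log_le_log (Real.exp_pos _) h1
    rw [Real.log_exp, Real.log_mul hM.ne' two_ne_zero] at h2
    linarith
  have hmem : ∀ ζ ∈ Metric.ball (0 : ℂ) (r / 2), z₀ + ζ ∈ Metric.ball z₀ (r / 2) := by
    intro ζ hζ
    simpa [dist_eq_norm] using hζ
  have hbc := Complex.borelCaratheodory_zero (f := fun ζ => g (z₀ + ζ) - g z₀) (M := K + 2)
    (R := r / 2) (z := -z₀) (by linarith) ?_ ?_ (by positivity)
    (by rw [mem_ball_zero_iff, norm_neg]; linarith) (by simp)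
  · rw [add_neg_cancel, norm_neg] at hbc
    have h1 : 2 * (K + 2) * ‖z₀‖ / (r / 2 - ‖z₀‖) ≤ 2 * (K + 2) := by
      rw [div_le_iff₀ (by linarith)]
      nlinarith
    have h2 := (abs_le.1 ((Complex.abs_re_le_norm (g 0 - g z₀)).trans (hbc.trans h1))).1
    rw [Complex.sub_re] at h2
    linarith
  · intro ζ hζ
    have := (hg _ (hmem ζ hζ)).comp_const_add z₀ ζ
    exact (this.differentiableAt.sub_const _).differentiableWithinAt
  · intro ζ hζ
    have := hgup _ (hmem ζ hζ)
    simp only [Set.mem_ofPred_eq, Complex.sub_re]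
    linarith

/-- The image of the preimage contains the part of the sector in the covered disc, and Cauchy's
bound `|f'| ≤ 4 M / r` limits the expansion of area; `M` cancels. -/
theorem le_volume_preimage_sector_of_doubling {f : ℂ → ℂ} {r M K : ℝ} (hr : 0 < r) (hM : 0 < M)
    (hK : 0 ≤ K) (hf : DifferentiableOn ℂ f (Metric.ball 0 r)) (hf0 : f 0 = 0)
    (hfM : ∀ z ∈ Metric.ball (0 : ℂ) r, ‖f z‖ ≤ M) {z₀ : ℂ} (hz₀ : ‖z₀‖ ≤ r / 4)
    (hfz₀ : M * Real.exp (-K) ≤ ‖f z₀‖) {θ₁ θ₂ : ℝ} (hθ : θ₂ - θ₁ ≤ 2 * Real.pi) :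
    ENNReal.ofReal (Real.exp (-(3 * K + 7)) ^ 2 * r ^ 2 / 16 * (θ₂ - θ₁)) ≤
      MeasureTheory.volume (f ⁻¹' sector θ₁ θ₂ ∩ Metric.ball 0 r) := by
  have hcov := ball_subset_image_of_doubling hr hM hK hf hf0 hfM hz₀ hfz₀
  have hsub : Metric.ball (0 : ℂ) (3 * r / 4) ⊆ Metric.ball 0 r :=
    Metric.ball_subset_ball (by linarith)
  set A : Set ℂ := f ⁻¹' sector θ₁ θ₂ ∩ Metric.ball 0 (3 * r / 4) with hA
  have hAm : MeasurableSet A := by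
    have := (hf.continuousOn.mono hsub).isOpen_inter_preimage
      Metric.isOpen_ball (isOpen_sector θ₁ θ₂)
    rw [Set.inter_comm] at this
    exact this.measurableSet
  have himg : sector θ₁ θ₂ ∩ Metric.ball 0 (M * Real.exp (-(3 * K + 6))) ⊆ f '' A := by
    rintro w ⟨hw1, hw2⟩
    obtain ⟨z, hz, rfl⟩ := hcov hw2
    exact ⟨z, ⟨hw1, hz⟩, rfl⟩
  have hder : ∀ z ∈ A, ‖deriv f z‖ ≤ 4 * M / r := by
    rintro z ⟨_, hz⟩
    rw [mem_ball_zero_iff] at hz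
    have hb : Metric.closedBall z (r / 4) ⊆ Metric.ball 0 r := by
      intro x hx
      rw [Metric.mem_closedBall, dist_eq_norm] at hx
      rw [mem_ball_zero_iff]
      have := norm_add_le (x - z) z
      rw [sub_add_cancel] at this
      linarith
    have := Complex.norm_deriv_le_of_forall_mem_sphere_norm_le (f := f) (c := z) (R := r / 4)
      (C := M) (by positivity) (DifferentiableOn.diffContOnCl (by
        rw [closure_ball _ (by positivity)]; exact hf.mono hb))
      (fun x hx => hfM x (hb (Metric.sphere_subset_closedBall hx)))
    refine this.trans (le_of_eq ?_)
    field_simp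
  have hvol := volume_image_le_of_norm_deriv_le hAm
    (fun z hz => (hf.differentiableAt (Metric.isOpen_ball.mem_nhds (hsub hz.2))).hasDerivAt) hder
  have hsec := (le_volume_sector_inter_ball (θ₁ := θ₁) (ρ := M * Real.exp (-(3 * K + 6))) hθ
    (by positivity)).trans ((MeasureTheory.measure_mono himg).trans hvol)
  have hpos : ENNReal.ofReal ((4 * M / r) ^ 2) ≠ 0 := (ENNReal.ofReal_pos.2 (by positivity)).ne'
  refine le_trans ?_ (MeasureTheory.measure_mono (Set.inter_subset_inter_right _ hsub))
  rw [← ENNReal.mul_le_mul_iff_right hpos ENNReal.ofReal_ne_top]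
  refine le_trans (le_of_eq ?_) hsec
  rw [← ENNReal.ofReal_mul (by positivity), ← ENNReal.ofReal_mul (by positivity), mul_assoc M,
    ← Real.exp_add]
  congr 1
  rw [show -(3 * K + 6) + -1 = -(3 * K + 7) by ring]
  field_simp
  norm_num

/-! ### Convexity of the maximum modulus and its slopes -/

/-- Hadamard's three circles theorem: the logarithm `m t` of the maximum of `|f|` over
`|z| ≤ eᵗ` is a convex function of `t`. -/
theorem exists_convexOn_log_max {f : ℂ → ℂ} (hf : AnalyticOnNhd ℂ f (Metric.ball 0 1))
    (hne : ∃ z ∈ Metric.ball (0 : ℂ) 1, f z ≠ 0) :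
    ∃ m : ℝ → ℝ, ConvexOn ℝ (Set.Iio 0) m ∧
      (∀ t < 0, ∀ z : ℂ, ‖z‖ ≤ Real.exp t → ‖f z‖ ≤ Real.exp (m t)) ∧
      ∀ t < 0, ∃ z : ℂ, ‖z‖ = Real.exp t ∧ ‖f z‖ = Real.exp (m t) := by
  have hsub : ∀ t : ℝ, t < 0 → Metric.closedBall (0 : ℂ) (Real.exp t) ⊆ Metric.ball 0 1 :=
    fun t ht => Metric.closedBall_subset_ball (Real.exp_lt_one_iff.2 ht)
  have hmax : ∀ t : ℝ, ∃ y : ℝ, t < 0 →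
      (∀ z : ℂ, ‖z‖ ≤ Real.exp t → ‖f z‖ ≤ Real.exp y) ∧
      ∃ z : ℂ, ‖z‖ = Real.exp t ∧ ‖f z‖ = Real.exp y := by
    intro t
    by_cases ht : t < 0
    swap
    · exact ⟨0, fun h => absurd h ht⟩
    have hpos := Real.exp_pos t
    obtain ⟨w, hw, hmax⟩ := Complex.exists_mem_frontier_isMaxOn_norm (f := f)
      (U := Metric.ball (0 : ℂ) (Real.exp t)) Metric.isBounded_ball ⟨0, Metric.mem_ball_self hpos⟩
      (DifferentiableOn.diffContOnCl (by
        rw [closure_ball _ hpos.ne']; exact hf.differentiableOn.mono (hsub t ht)))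
    rw [frontier_ball _ hpos.ne', mem_sphere_zero_iff_norm] at hw
    rw [closure_ball _ hpos.ne'] at hmax
    have hle : ∀ z : ℂ, ‖z‖ ≤ Real.exp t → ‖f z‖ ≤ ‖f w‖ := fun z hz =>
      hmax (mem_closedBall_zero_iff.2 hz)
    have hfw : 0 < ‖f w‖ := by
      rw [norm_pos_iff]
      intro hfw0
      obtain ⟨z₁, hz₁, hfz₁⟩ := hne
      refine hfz₁ (hf.eqOn_zero_of_preconnected_of_eventuallyEq_zero
        (convex_ball (0 : ℂ) 1).isPreconnected (Metric.mem_ball_self one_pos) ?_ hz₁)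
      filter_upwards [Metric.ball_mem_nhds (0 : ℂ) hpos] with z hz
      have := hle z (mem_ball_zero_iff.1 hz).le
      rw [hfw0, norm_zero] at this
      exact norm_le_zero_iff.1 this
    refine ⟨Real.log ‖f w‖, fun _ => ?_⟩
    rw [Real.exp_log hfw]
    exact ⟨hle, w, hw, rfl⟩
  choose m hm using hmax
  refine ⟨m, ?_, fun t ht => (hm t ht).1, fun t ht => (hm t ht).2⟩
  refine ⟨convex_Iio 0, ?_⟩
  have key : ∀ s u : ℝ, s < u → u < 0 → ∀ a b : ℝ, 0 ≤ a → 0 ≤ b → a + b = 1 →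
      m (a * s + b * u) ≤ a * m s + b * m u := by
    intro s u hsu hu a b ha hb hab
    have hs : s < 0 := hsu.trans hu
    set t := a * s + b * u with ht
    have hst : s ≤ t := by
      have : t - s = b * (u - s) := by rw [ht, ← eq_sub_iff_add_eq.2 hab |>.symm]; ring
      nlinarith
    have htu : t ≤ u := by
      have : u - t = a * (u - s) := by rw [ht, show b = 1 - a by linarith]; ring
      nlinarith
    obtain ⟨z, hz, hfz⟩ := (hm t (by linarith)).2
    have hz0 : z ≠ 0 := by rw [← norm_pos_iff, hz]; exact Real.exp_pos t
    have hre : (Complex.log z).re = t := by rw [Complex.log_re, hz, Real.log_exp]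
    have hexp : Complex.exp (Complex.log z) = z := Complex.exp_log hz0
    have hstrip : ∀ ζ : ℂ, ζ.re ≤ u → ‖Complex.exp ζ‖ ≤ Real.exp u := by
      intro ζ hζ
      rw [Complex.norm_exp]
      exact Real.exp_le_exp.2 hζ
    have hball : ∀ ζ : ℂ, ζ.re ≤ u → Complex.exp ζ ∈ Metric.ball (0 : ℂ) 1 := fun ζ hζ =>
      hsub u hu (mem_closedBall_zero_iff.2 (hstrip ζ hζ))
    -- Three lines theorem for `f ∘ exp` on the strip `s ≤ Re ζ ≤ u`, at a logarithm of a maximum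
    -- point on `|z| = eᵗ`.
    have h3 := Complex.HadamardThreeLines.norm_le_interp_of_mem_verticalClosedStrip'
      (f := fun ζ => f (Complex.exp ζ)) (z := Complex.log z) (a := Real.exp (m s))
      (b := Real.exp (m u)) hsu ?_ ?_ ?_ ?_ ?_
    · simp only [hexp, hre, hfz] at h3
      have hb' : (t - s) / (u - s) = b := by
        rw [div_eq_iff (by linarith), ht, show a = 1 - b by linarith]; ring
      rw [hb', ← Real.exp_mul, ← Real.exp_mul, ← Real.exp_add, Real.exp_le_exp] at h3
      rw [show a = 1 - b by linarith]
      linarith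
    · exact ⟨by rw [hre]; exact hst, by rw [hre]; exact htu⟩
    · refine DifferentiableOn.diffContOnCl ?_
      have hcl : closure (Complex.HadamardThreeLines.verticalStrip s u) ⊆ {ζ : ℂ | ζ.re ≤ u} :=
        closure_minimal (fun ζ hζ => hζ.2.le) (isClosed_le Complex.continuous_re continuous_const)
      intro ζ hζ
      exact ((hf _ (hball ζ (hcl hζ))).differentiableAt.comp ζ
        Complex.differentiableAt_exp).differentiableWithinAt
    · refine ⟨Real.exp (m u), ?_⟩
      rintro _ ⟨ζ, hζ, rfl⟩
      exact (hm u hu).1 _ (hstrip ζ hζ.2)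
    · intro ζ hζ
      have hζ : ζ.re = s := hζ
      exact (hm s hs).1 _ (by rw [Complex.norm_exp, hζ])
    · intro ζ hζ
      have hζ : ζ.re = u := hζ
      exact (hm u hu).1 _ (by rw [Complex.norm_exp, hζ])
  intro s hs u hu a b ha hb hab
  simp only [smul_eq_mul]
  rcases lt_trichotomy s u with h | h | h
  · exact key s u h hu a b ha hb hab
  · subst h
    rw [← add_mul, ← add_mul, hab, one_mul, one_mul]
  · have := key u s h hs b a hb ha (by linarith)
    rw [add_comm, add_comm (a * m s)]
    exact this

/-- The point of `[t₀, t₁]` up to which the slopes of the convex function `m` are below `V`. -/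
noncomputable def slopeThreshold (m : ℝ → ℝ) (t₀ t₁ V : ℝ) : ℝ :=
  sSup {t | t₀ ≤ t ∧ t ≤ t₁ ∧ (t = t₀ ∨ ∃ t', t < t' ∧ t' ≤ t₁ ∧ m t' - m t < V * (t' - t))}

section slopeThreshold

variable {m : ℝ → ℝ} {t₀ t₁ V : ℝ}

theorem slopeThreshold_bddAbove : BddAbove {t | t₀ ≤ t ∧ t ≤ t₁ ∧
    (t = t₀ ∨ ∃ t', t < t' ∧ t' ≤ t₁ ∧ m t' - m t < V * (t' - t))} :=
  ⟨t₁, fun _ ht => ht.2.1⟩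

/-- The disjunct `t = t₀` in the definition keeps the set nonempty; otherwise `sSup` could take its
default value `0`. -/
theorem left_le_slopeThreshold (h : t₀ ≤ t₁) : t₀ ≤ slopeThreshold m t₀ t₁ V :=
  le_csSup slopeThreshold_bddAbove ⟨le_rfl, h, Or.inl rfl⟩

theorem slopeThreshold_le_right (h : t₀ ≤ t₁) : slopeThreshold m t₀ t₁ V ≤ t₁ :=
  csSup_le ⟨t₀, le_rfl, h, Or.inl rfl⟩ fun _ ht => ht.2.1

theorem slopeThreshold_mono (h : t₀ ≤ t₁) {V W : ℝ} (hVW : V ≤ W) :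
    slopeThreshold m t₀ t₁ V ≤ slopeThreshold m t₀ t₁ W := by
  refine csSup_le_csSup slopeThreshold_bddAbove ⟨t₀, le_rfl, h, Or.inl rfl⟩ ?_
  rintro t ⟨h1, h2, h3⟩
  refine ⟨h1, h2, h3.imp_right ?_⟩
  rintro ⟨t', h4, h5, h6⟩
  exact ⟨t', h4, h5, h6.trans_le (mul_le_mul_of_nonneg_right hVW (by linarith))⟩

theorem le_sub_of_slopeThreshold_lt (h : t₀ ≤ t₁) {x y : ℝ} (hx : slopeThreshold m t₀ t₁ V < x)
    (hxy : x ≤ y) (hy : y ≤ t₁) : V * (y - x) ≤ m y - m x := by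
  rcases hxy.eq_or_lt with rfl | hxy
  · simp
  by_contra hlt
  push Not at hlt
  refine absurd hx (not_lt.2 (le_csSup slopeThreshold_bddAbove ⟨?_, by linarith, Or.inr
    ⟨y, hxy, hy, hlt⟩⟩))
  exact (left_le_slopeThreshold h).trans hx.le

/-- Some chord starting beyond `y` has slope below `V`, and by convexity chords further left are no
steeper. The point `x` may lie to the left of `t₀`. -/
theorem sub_le_of_lt_slopeThreshold (hm : ConvexOn ℝ (Set.Iio 0) m) (h : t₀ ≤ t₁) (h1 : t₁ < 0)
    {x y : ℝ} (hxy : x ≤ y) (hy0 : t₀ ≤ y) (hy : y < slopeThreshold m t₀ t₁ V) :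
    m y - m x ≤ V * (y - x) := by
  rcases hxy.eq_or_lt with rfl | hxy
  · simp
  obtain ⟨t, ⟨ht0, ht1, ht⟩, hyt⟩ := exists_lt_of_lt_csSup
    (s := {t | t₀ ≤ t ∧ t ≤ t₁ ∧
      (t = t₀ ∨ ∃ t', t < t' ∧ t' ≤ t₁ ∧ m t' - m t < V * (t' - t))}) ⟨t₀, le_rfl, h, Or.inl rfl⟩ hy
  rcases ht with rfl | ⟨t', htt', ht', hlt⟩
  · linarith
  have hs1 := hm.slope_mono_adjacent (x := x) (y := y) (z := t) (Set.mem_Iio.2 (by linarith))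
    (Set.mem_Iio.2 (by linarith)) hxy hyt
  have hs2 := hm.slope_mono_adjacent (x := y) (y := t) (z := t') (Set.mem_Iio.2 (by linarith))
    (Set.mem_Iio.2 (by linarith)) hyt htt'
  have h3 : (m t' - m t) / (t' - t) ≤ V := by
    rw [div_le_iff₀ (by linarith)]; exact hlt.le
  have h4 := hs1.trans (hs2.trans h3)
  rwa [div_le_iff₀ (by linarith)] at h4

theorem slopeThreshold_eq_right (h : t₀ ≤ t₁)
    (hV : ∀ x < t₁, t₀ ≤ x → m t₁ - m x < V * (t₁ - x)) : slopeThreshold m t₀ t₁ V = t₁ := by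
  refine le_antisymm (slopeThreshold_le_right h) ?_
  by_contra hlt
  push Not at hlt
  obtain ⟨x, hx1, hx2⟩ := exists_between hlt
  have h1 := le_sub_of_slopeThreshold_lt h hx1 hx2.le le_rfl
  have h2 := hV x hx2 ((left_le_slopeThreshold h).trans hx1.le)
  linarith

end slopeThreshold

/-! ### Dyadic annuli and summation -/

/-- An annulus `eᵃ < |z| < eᵇ` in which the logarithm of the maximum modulus of `f` has slope
between `V` and `2 V` contains a disc of radius comparable to `b - a` in which the values of `f`
fill a fixed proportion of every sector. -/
theorem exists_le_volume_preimage_sector_annulus :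
    ∃ c κ : ℝ, 0 < c ∧ 0 < κ ∧ ∀ (f : ℂ → ℂ) (m : ℝ → ℝ) (a b V : ℝ),
      AnalyticOnNhd ℂ f (Metric.ball 0 1) →
      (∀ t < 0, ∀ z : ℂ, ‖z‖ ≤ Real.exp t → ‖f z‖ ≤ Real.exp (m t)) →
      (∀ t < 0, ∃ z : ℂ, ‖z‖ = Real.exp t ∧ ‖f z‖ = Real.exp (m t)) →
      -(2 * Real.log 2) ≤ a → a < b → b ≤ -Real.log 2 →
      (∀ x y, a < x → x ≤ y → y < b → V * (y - x) ≤ m y - m x ∧ m y - m x ≤ 2 * V * (y - x)) →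
      κ ≤ V * (b - a) →
      ∀ θ₁ θ₂ : ℝ, 0 ≤ θ₂ - θ₁ → θ₂ - θ₁ ≤ 2 * Real.pi →
        ENNReal.ofReal (c * (b - a) ^ 2 * (θ₂ - θ₁)) ≤
          MeasureTheory.volume (f ⁻¹' sector θ₁ θ₂ ∩ {z | Real.exp a < ‖z‖ ∧ ‖z‖ < Real.exp b}) := by
  obtain ⟨c, N₀, hc, hN, H⟩ := exists_le_volume_preimage_sector_of_growth_ball
  refine ⟨c / 1024, 32 * N₀, by positivity, by positivity, ?_⟩
  intro f m a b V hf hm1 hm2 ha hab hb hV hκ θ₁ θ₂ hθ0 hθ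
  have hlog2 := Real.log_two_lt_d9
  have hlog2' := Real.log_two_gt_d9
  set ℓ := b - a with hℓ
  have hℓ0 : 0 < ℓ := by linarith
  have hℓ1 : ℓ < 1 := by linarith
  set p := (a + b) / 2 with hp
  have hp0 : p < 0 := by linarith
  obtain ⟨y, hy, hfy⟩ := hm2 p hp0
  set r := Real.exp p with hr
  have hr0 : 0 < r := Real.exp_pos p
  have hr4 : 1 / 4 ≤ r := by
    have h1 : Real.exp (-(2 * Real.log 2)) = 1 / 4 := by
      rw [Real.exp_neg, two_mul, Real.exp_add, Real.exp_log two_pos]; norm_num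
    rw [← h1]
    exact Real.exp_le_exp.2 (by linarith)
  set η := r * ℓ / 8 with hη
  have hη0 : 0 < η := by positivity
  -- `Δ` plays the role of `n`, with level `A = exp (m p - Δ)`. Moving out by `ℓ / 8` in `t` raises
  -- `m` by at most `2 V ℓ / 8 = 8 Δ`, whence the exponent `9 n`.
  set Δ := V * ℓ / 32 with hΔ
  have hΔN : N₀ ≤ Δ := by
    rw [hΔ, le_div_iff₀ (by norm_num)]; linarith
  have hup : r + η ≤ Real.exp (p + ℓ / 8) := by
    rw [Real.exp_add, ← hr, hη]
    have := Real.add_one_le_exp (ℓ / 8)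
    nlinarith
  have hdown : ∀ s : ℝ, s ≤ 1 → r * Real.exp (-(ℓ / 4)) ≤ r - s * η := by
    intro s hs
    have h1 : Real.exp (-(ℓ / 4)) ≤ 1 - ℓ / 8 := by
      rw [Real.exp_neg, inv_le_comm₀ (Real.exp_pos _) (by linarith)]
      refine le_trans ?_ (Real.add_one_le_exp (ℓ / 4))
      rw [inv_le_iff_one_le_mul₀ (by linarith)]
      nlinarith
    have h2 : r * Real.exp (-(ℓ / 4)) ≤ r * (1 - ℓ / 8) := by gcongr
    have h3 : s * η ≤ 1 * η := by gcongr
    rw [hη] at h3 ⊢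
    linarith
  have hnorm : ∀ z ∈ Metric.closedBall y η, ‖z‖ ≤ Real.exp (p + ℓ / 8) ∧
      Real.exp (p - ℓ / 4) ≤ ‖z‖ := by
    intro z hz
    rw [Metric.mem_closedBall, dist_eq_norm] at hz
    constructor
    · have := norm_add_le (z - y) y
      rw [sub_add_cancel] at this
      linarith
    · have h1 := norm_sub_le z (z - y)
      rw [sub_sub_cancel] at h1
      have h2 := hdown 1 le_rfl
      rw [sub_eq_add_neg p, Real.exp_add]
      linarith
  have hlt1 : p + ℓ / 8 < 0 := by rw [hp, hℓ]; linarith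
  have key := H f y η Δ (Real.exp (m p - Δ)) hη0 (Real.exp_pos _) hΔN
    (fun z hz => hf z (mem_ball_zero_iff.2 ((hnorm z hz).1.trans_lt (Real.exp_lt_one_iff.2 hlt1))))
    ?_ ?_ ?_ θ₁ θ₂ hθ0 hθ
  · refine le_trans (ENNReal.ofReal_le_ofReal ?_) (key.trans (MeasureTheory.measure_mono ?_))
    · have h1 : ℓ / 32 ≤ η := by rw [hη]; nlinarith
      have h2 : (ℓ / 32) ^ 2 ≤ η ^ 2 := by gcongr
      have h3 : c / 1024 * ℓ ^ 2 = c * (ℓ / 32) ^ 2 := by ring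
      rw [h3]
      gcongr
    · rintro z ⟨hz1, hz2⟩
      obtain ⟨h1, h2⟩ := hnorm z (Metric.ball_subset_closedBall hz2)
      refine ⟨hz1, ?_, ?_⟩
      · exact (Real.exp_lt_exp.2 (by rw [hp, hℓ]; linarith)).trans_le h2
      · exact h1.trans_lt (Real.exp_lt_exp.2 (by rw [hp, hℓ]; linarith))
  · intro z hz
    refine (hm1 _ hlt1 z (hnorm z hz).1).trans ?_
    rw [← Real.exp_add, Real.exp_le_exp]
    have := (hV p (p + ℓ / 8) (by linarith) (by linarith) (by linarith)).2
    rw [hΔ]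
    linarith
  · rw [hfy, ← Real.exp_add, Real.exp_le_exp]
    linarith
  · intro s hs1 hs2
    have hy0 : (r : ℂ) ≠ 0 := by exact_mod_cast hr0.ne'
    have hsη : s * η / r = s * ℓ / 8 := by rw [hη]; field_simp
    -- The point reached from `y` by moving radially inwards by `s η`. As `s ≥ 1/4`, its modulus is
    -- at most `e^(p - ℓ/32)`, where `m` has dropped by at least `Δ`.
    refine ⟨y - ((s * η / r : ℝ) : ℂ) * y, ?_, ?_⟩
    · rw [sub_sub_cancel_left, norm_neg, norm_mul, hy, Complex.norm_real,
        Real.norm_of_nonneg (by positivity), div_mul_cancel₀ _ hr0.ne']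
    · have h1 : ‖y - ((s * η / r : ℝ) : ℂ) * y‖ ≤ Real.exp (p - ℓ / 32) := by
        have e : y - ((s * η / r : ℝ) : ℂ) * y = ((1 - s * η / r : ℝ) : ℂ) * y := by
          push_cast; ring
        rw [e, norm_mul, hy, Complex.norm_real, hsη, Real.norm_of_nonneg (by nlinarith),
          sub_eq_add_neg p, Real.exp_add, mul_comm]
        refine mul_le_mul_of_nonneg_left ?_ hr0.le
        have := Real.add_one_le_exp (-(ℓ / 32))
        nlinarith
      refine (hm1 _ (by linarith) _ h1).trans (Real.exp_le_exp.2 ?_)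
      have := (hV (p - ℓ / 32) p (by linarith) (by linarith) (by linarith)).1
      rw [hΔ]
      linarith

/-- Summing areas over the consecutive annuli `e^{a j} < |z| < e^{a (j+1)}`. -/
theorem sum_volume_annuli_le {a : ℕ → ℝ} (ha : Monotone a) (E : Set ℂ) (hE : MeasurableSet E)
    (s : Finset ℕ) :
    ∑ j ∈ s, MeasureTheory.volume (E ∩ {z | Real.exp (a j) < ‖z‖ ∧ ‖z‖ < Real.exp (a (j + 1))}) ≤
      MeasureTheory.volume E := by
  rw [← MeasureTheory.measure_biUnion_finset]
  · exact MeasureTheory.measure_mono (Set.iUnion₂_subset fun _ _ => Set.inter_subset_left)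
  · have hlt : ∀ i j : ℕ, i < j → Disjoint
        (E ∩ {z : ℂ | Real.exp (a i) < ‖z‖ ∧ ‖z‖ < Real.exp (a (i + 1))})
        (E ∩ {z : ℂ | Real.exp (a j) < ‖z‖ ∧ ‖z‖ < Real.exp (a (j + 1))}) := by
      intro i j hij
      rw [Set.disjoint_left]
      rintro z ⟨_, _, h1⟩ ⟨_, h2, _⟩
      have := Real.exp_le_exp.2 (ha (Nat.succ_le_of_lt hij))
      exact absurd (h1.trans_le this) (not_lt.2 h2.le)
    intro i _ j _ hij
    rcases lt_or_gt_of_ne hij with h | h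
    · exact hlt i j h
    · exact (hlt j i h).symm
  · intro j _
    exact hE.inter ((isOpen_lt continuous_const continuous_norm).inter
      (isOpen_lt continuous_norm continuous_const)).measurableSet

/-- If intervals of total length at least `lam` are indexed by `j₀ ≤ j < J`, their lengths reduced
by `κ / 2 ^ j` still have a large sum of squares. -/
theorem le_sum_sq_of_sum_le {a : ℕ → ℝ} {κ lam : ℝ} {j₀ J : ℕ} (hJ : j₀ < J) (hκ : 0 ≤ κ)
    (hlam : 0 ≤ lam) (hκlam : 4 * κ ≤ lam * 2 ^ j₀) (hsum : lam ≤ a J - a j₀) :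
    (lam / 2) ^ 2 / J ≤
      ∑ j ∈ Finset.Ico j₀ J, (max (a (j + 1) - a j - κ / 2 ^ j) 0) ^ 2 := by
  -- The total reduction is a geometric sum, at most `lam / 2` by the choice of `j₀`; truncating at
  -- `0` discards the intervals that are too short.
  have hgeom : ∀ J, j₀ ≤ J → ∑ j ∈ Finset.Ico j₀ J, κ / 2 ^ j ≤ 2 * κ / 2 ^ j₀ - 2 * κ / 2 ^ J := by
    intro J hJ
    induction J, hJ using Nat.le_induction with
    | base => simp
    | succ k hk ih =>
      rw [Finset.sum_Ico_succ_top hk]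
      have : 2 * κ / 2 ^ (k + 1) = κ / 2 ^ k := by rw [pow_succ]; field_simp
      have h2 : 2 * κ / 2 ^ k = κ / 2 ^ k + κ / 2 ^ k := by ring
      linarith
  have h1 : lam / 2 ≤ ∑ j ∈ Finset.Ico j₀ J, max (a (j + 1) - a j - κ / 2 ^ j) 0 := by
    have h2 : ∑ j ∈ Finset.Ico j₀ J, (a (j + 1) - a j - κ / 2 ^ j) ≤
        ∑ j ∈ Finset.Ico j₀ J, max (a (j + 1) - a j - κ / 2 ^ j) 0 :=
      Finset.sum_le_sum fun _ _ => le_max_left _ _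
    rw [Finset.sum_sub_distrib, Finset.sum_Ico_sub a hJ.le] at h2
    have h3 := hgeom J hJ.le
    have h4 : 2 * κ / 2 ^ j₀ ≤ lam / 2 := by
      rw [div_le_iff₀ (by positivity)]; linarith
    have h5 : 0 ≤ 2 * κ / 2 ^ J := by positivity
    linarith
  have hcs := sq_sum_le_card_mul_sum_sq (s := Finset.Ico j₀ J)
    (f := fun j => max (a (j + 1) - a j - κ / 2 ^ j) 0)
  rw [Nat.card_Ico] at hcs
  have hJ0 : (0 : ℝ) < J := by exact_mod_cast (Nat.zero_le _).trans_lt hJ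
  rw [div_le_iff₀ hJ0]
  have h6 : (lam / 2) ^ 2 ≤ (∑ j ∈ Finset.Ico j₀ J, max (a (j + 1) - a j - κ / 2 ^ j) 0) ^ 2 := by
    gcongr
  refine h6.trans (hcs.trans ?_)
  rw [mul_comm]
  refine mul_le_mul_of_nonneg_left ?_ (Finset.sum_nonneg fun _ _ => sq_nonneg _)
  exact_mod_cast Nat.sub_le _ _

/-- The logarithm of the maximum modulus has slope at most `4 B` up to radius `1/2`. -/
theorem sub_le_of_log_max_le {m : ℝ → ℝ} {B x : ℝ} (hm : ConvexOn ℝ (Set.Iio 0) m)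
    (hB : ∀ t < 0, m t - m (-Real.log 2) ≤ B) (hB0 : 0 ≤ B) (hx : x < -Real.log 2) :
    m (-Real.log 2) - m x ≤ 4 * B * (-Real.log 2 - x) := by
  have hlog2 := Real.log_two_gt_d9
  -- The chord to the right has length `log 2 / 2` and rise at most `B`, so slope at most `2 B / log
  -- 2 ≤ 4 B`.
  have hs := hm.slope_mono_adjacent (x := x) (y := -Real.log 2) (z := -Real.log 2 / 2)
    (Set.mem_Iio.2 (by linarith)) (Set.mem_Iio.2 (by linarith)) hx (by linarith)
  have h1 : (m (-Real.log 2 / 2) - m (-Real.log 2)) / (-Real.log 2 / 2 - -Real.log 2) ≤ 4 * B := by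
    rw [div_le_iff₀ (by linarith)]
    have := hB (-Real.log 2 / 2) (by linarith)
    nlinarith
  have h2 := hs.trans h1
  rwa [div_le_iff₀ (by linarith)] at h2

/-- Counts the dyadic slope levels up to `4 B`; `B ≥ 2` lets the additive constants be absorbed into
`log B`. -/
theorem exists_pow_two_le_mul_log {B : ℝ} (hB : 2 ≤ B) :
    ∃ J : ℕ, 0 < J ∧ 4 * B < 2 ^ J ∧ (J : ℝ) ≤ 8 * Real.log B := by
  have hlog2 := Real.log_two_gt_d9
  have hlogB : Real.log 2 ≤ Real.log B := Real.log_le_log two_pos hB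
  have hlog4 : Real.log (4 * B) = 2 * Real.log 2 + Real.log B := by
    rw [Real.log_mul (by norm_num) (by linarith), show (4 : ℝ) = 2 ^ 2 by norm_num, Real.log_pow]
    push_cast
    ring
  refine ⟨⌊Real.log (4 * B) / Real.log 2⌋₊ + 1, Nat.succ_pos _, ?_, ?_⟩
  · rw [← Real.log_lt_log_iff (by linarith) (by positivity), Real.log_pow,
      ← div_lt_iff₀ (by linarith)]
    push_cast
    exact Nat.lt_floor_add_one _
  · push_cast
    have h1 : (⌊Real.log (4 * B) / Real.log 2⌋₊ : ℝ) ≤ Real.log (4 * B) / Real.log 2 :=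
      Nat.floor_le (div_nonneg (by linarith) (by linarith))
    have h2 : Real.log (4 * B) / Real.log 2 + 1 ≤ 8 * Real.log B := by
      rw [div_add_one (by linarith), div_le_iff₀ (by linarith), hlog4]
      nlinarith
    linarith

/-! ### Assembly -/

/-- The area estimate for a function whose maximum modulus grows at most by the factor `e^B`
between the discs of radius `1/2` and `1`. -/
theorem exists_le_volume_preimage_sector :
    ∃ c : ℝ, 0 < c ∧ ∀ f : ℂ → ℂ, AnalyticOnNhd ℂ f (Metric.ball 0 1) → f 0 = 0 →
      (∃ z ∈ Metric.ball (0 : ℂ) 1, f z ≠ 0) → ∀ B : ℝ, 2 ≤ B →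
      (∀ z ∈ Metric.ball (0 : ℂ) 1, ∃ z' ∈ Metric.closedBall (0 : ℂ) (1 / 2),
        ‖f z‖ ≤ Real.exp B * ‖f z'‖) →
      ∀ θ₁ θ₂ : ℝ, 0 ≤ θ₂ - θ₁ → θ₂ - θ₁ ≤ 2 * Real.pi →
        ENNReal.ofReal (c * (θ₂ - θ₁) / Real.log B) ≤
          MeasureTheory.volume (f ⁻¹' sector θ₁ θ₂ ∩ Metric.ball 0 1) := by
  obtain ⟨c₁, κ, hc₁, hκ, H⟩ := exists_le_volume_preimage_sector_annulus
  have hlog2 := Real.log_two_gt_d9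
  have hlog2' := Real.log_two_lt_d9
  obtain ⟨j₀, hj₀⟩ := pow_unbounded_of_one_lt (4 * κ / (Real.log 2 / 2)) one_lt_two
  have hj₀' : 4 * κ ≤ Real.log 2 / 2 * 2 ^ j₀ := by
    rw [div_lt_iff₀ (by linarith)] at hj₀
    linarith
  set t₀ := -(2 * Real.log 2) with ht₀
  set t₁ := -Real.log 2 with ht₁
  set τ := -(3 / 2 * Real.log 2) with hτ
  have ht01 : t₀ ≤ t₁ := by linarith
  have ht10 : t₁ < 0 := by linarith
  set K := (2 : ℝ) ^ j₀ * (2 * Real.log 2) with hK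
  have hK0 : 0 ≤ K := by positivity
  set c₂ := Real.exp (-(3 * K + 7)) ^ 2 * Real.exp τ ^ 2 / 16 * Real.log 2 with hc₂
  set c₃ := c₁ * (Real.log 2 / 2 / 2) ^ 2 / 8 with hc₃
  have hc₂0 : 0 < c₂ := by positivity
  have hc₃0 : 0 < c₃ := by positivity
  refine ⟨min c₂ c₃, lt_min hc₂0 hc₃0, ?_⟩
  intro f hf hf0 hne B hB hdoub θ₁ θ₂ hθ0 hθ
  have hlogB : Real.log 2 ≤ Real.log B := Real.log_le_log two_pos hB
  have hlogB0 : 0 < Real.log B := by linarith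
  obtain ⟨m, hm, hm1, hm2⟩ := exists_convexOn_log_max hf hne
  have hexpt₁ : Real.exp t₁ = 1 / 2 := by
    rw [ht₁, Real.exp_neg, Real.exp_log two_pos]; norm_num
  have hmB : ∀ t < 0, m t - m t₁ ≤ B := by
    intro t ht
    obtain ⟨z, hz, hfz⟩ := hm2 t ht
    obtain ⟨z', hz', hle⟩ := hdoub z (by rw [mem_ball_zero_iff, hz]; exact Real.exp_lt_one_iff.2 ht)
    have h1 := hm1 t₁ ht10 z' (by rw [hexpt₁]; exact mem_closedBall_zero_iff.1 hz')
    have h2 : Real.exp (m t) ≤ Real.exp (B + m t₁) := by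
      rw [← hfz, Real.exp_add]
      exact hle.trans (by gcongr)
    have := Real.exp_le_exp.1 h2
    linarith
  set a : ℕ → ℝ := fun j => slopeThreshold m t₀ t₁ (2 ^ j) with ha
  have hamono : Monotone a := fun i j hij =>
    slopeThreshold_mono ht01 (pow_le_pow_right₀ one_le_two hij)
  set E : Set ℂ := f ⁻¹' sector θ₁ θ₂ ∩ Metric.ball 0 1 with hE
  have hEm : MeasurableSet E := by
    have := hf.continuousOn.isOpen_inter_preimage Metric.isOpen_ball (isOpen_sector θ₁ θ₂)
    rw [Set.inter_comm] at this
    exact this.measurableSet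
  -- `τ` is the midpoint of `[t₀, t₁]`. Either slopes are at most `2 ^ j₀` up to `τ`, so the growth
  -- from radius `e^τ / 4` to `e^τ` is at most `e^K`, or the levels from `j₀` on occupy length at
  -- least `log 2 / 2`.
  by_cases hcase : τ < a j₀
  · have hτ0 : τ < 0 := by linarith
    have hsub : Metric.ball (0 : ℂ) (Real.exp τ) ⊆ Metric.ball 0 1 :=
      Metric.ball_subset_ball (Real.exp_lt_one_iff.2 hτ0).le
    obtain ⟨z₀, hz₀, hfz₀⟩ := hm2 (τ - 2 * Real.log 2) (by linarith)
    have hslope := sub_le_of_lt_slopeThreshold (V := 2 ^ j₀) hm ht01 ht10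
      (x := τ - 2 * Real.log 2) (y := τ) (by linarith) (by linarith) hcase
    rw [sub_sub_cancel, ← hK] at hslope
    have key := le_volume_preimage_sector_of_doubling (f := f) (r := Real.exp τ)
      (M := Real.exp (m τ)) (K := K) (z₀ := z₀) (Real.exp_pos _) (Real.exp_pos _) hK0
      (hf.differentiableOn.mono hsub) hf0
      (fun z hz => hm1 τ hτ0 z (mem_ball_zero_iff.1 hz).le) ?_ ?_ hθ
    · refine le_trans (ENNReal.ofReal_le_ofReal ?_)
        (key.trans (MeasureTheory.measure_mono (Set.inter_subset_inter_right _ hsub)))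
      rw [div_le_iff₀ hlogB0]
      calc min c₂ c₃ * (θ₂ - θ₁) ≤ c₂ * (θ₂ - θ₁) := by
            gcongr; exact min_le_left _ _
        _ = Real.exp (-(3 * K + 7)) ^ 2 * Real.exp τ ^ 2 / 16 * (θ₂ - θ₁) * Real.log 2 := by
            rw [hc₂]; ring
        -- In this case the area bound has no logarithm; `log 2 ≤ log B` brings it to the required
        -- form.
        _ ≤ _ := by gcongr
    · have h4 : Real.exp (2 * Real.log 2) = 4 := by
        rw [two_mul, Real.exp_add, Real.exp_log two_pos]; norm_num
      rw [hz₀, Real.exp_sub, h4]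
    · rw [hfz₀, ← Real.exp_add, Real.exp_le_exp]
      linarith
  · push Not at hcase
    obtain ⟨J, hJ0, hJB, hJlog⟩ := exists_pow_two_le_mul_log hB
    have haJ : a J = t₁ := by
      refine slopeThreshold_eq_right ht01 fun x hx _ => ?_
      refine (sub_le_of_log_max_le hm hmB (by linarith) hx).trans_lt ?_
      exact mul_lt_mul_of_pos_right hJB (by linarith)
    have hjJ : j₀ < J := by
      by_contra h
      have := hamono (not_lt.1 h)
      linarith
    have hsq := le_sum_sq_of_sum_le (a := a) (κ := κ) (lam := Real.log 2 / 2) hjJ hκ.le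
      (by linarith) hj₀' (by rw [haJ]; linarith)
    have hterm : ∀ j ∈ Finset.Ico j₀ J,
        ENNReal.ofReal (c₁ * (max (a (j + 1) - a j - κ / 2 ^ j) 0) ^ 2 * (θ₂ - θ₁)) ≤
          MeasureTheory.volume
            (E ∩ {z | Real.exp (a j) < ‖z‖ ∧ ‖z‖ < Real.exp (a (j + 1))}) := by
      intro j _
      rcases le_or_gt (a (j + 1) - a j - κ / 2 ^ j) 0 with h | h
      · rw [max_eq_right h]; simp
      have hκj : 0 < κ / 2 ^ j := by positivity
      have haj1 : a (j + 1) ≤ t₁ := slopeThreshold_le_right ht01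
      have haj0 : t₀ ≤ a j := left_le_slopeThreshold ht01
      have key := H f m (a j) (a (j + 1)) (2 ^ j) hf hm1 hm2 haj0 (by linarith) haj1 ?_ ?_ θ₁ θ₂
        hθ0 hθ
      · refine (ENNReal.ofReal_le_ofReal ?_).trans (key.trans (MeasureTheory.measure_mono ?_))
        · rw [max_eq_left h.le]
          exact mul_le_mul_of_nonneg_right (mul_le_mul_of_nonneg_left
            (pow_le_pow_left₀ h.le (by linarith) 2) hc₁.le) hθ0
        · rintro z ⟨hz1, hz2⟩
          refine ⟨⟨hz1, ?_⟩, hz2⟩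
          rw [mem_ball_zero_iff]
          exact hz2.2.trans (Real.exp_lt_one_iff.2 (by linarith))
      · intro x y hx hxy hy
        refine ⟨le_sub_of_slopeThreshold_lt ht01 hx hxy (by linarith), ?_⟩
        rw [← pow_succ']
        exact sub_le_of_lt_slopeThreshold hm ht01 ht10 hxy (by linarith) hy
      · rw [mul_comm, ← div_le_iff₀ (by positivity)]
        linarith
    have hJpos : (0 : ℝ) < J := by exact_mod_cast hJ0
    refine le_trans ?_ (sum_volume_annuli_le hamono E hEm (Finset.Ico j₀ J))
    refine le_trans ?_ (Finset.sum_le_sum hterm)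
    rw [← ENNReal.ofReal_sum_of_nonneg fun j _ => by positivity]
    refine ENNReal.ofReal_le_ofReal ?_
    rw [← Finset.sum_mul, ← Finset.mul_sum]
    calc min c₂ c₃ * (θ₂ - θ₁) / Real.log B ≤ c₃ * (θ₂ - θ₁) / Real.log B := by
          gcongr; exact min_le_right _ _
      _ = c₁ * ((Real.log 2 / 2 / 2) ^ 2 / (8 * Real.log B)) * (θ₂ - θ₁) := by
          rw [hc₃]; field_simp
      _ ≤ c₁ * ((Real.log 2 / 2 / 2) ^ 2 / J) * (θ₂ - θ₁) := by gcongr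
      _ ≤ _ := by gcongr

/-- Either `f` is unbounded, and then the logarithm of `β*` is infinite, or `log β*` is the
logarithm of a real number which controls the growth of `f`. -/
theorem elog_doublingExponentStar_eq {f : ℂ → ℂ} (hf : AnalyticOnNhd ℂ f (Metric.ball 0 1))
    (hne : ∃ z ∈ Metric.ball (0 : ℂ) 1, f z ≠ 0) :
    elog (doublingExponentStar 0 1 f) = ⊤ ∨
      ∃ B : ℝ, 2 ≤ B ∧ elog (doublingExponentStar 0 1 f) = (Real.log B : EReal) ∧
        ∀ z ∈ Metric.ball (0 : ℂ) 1, ∃ z' ∈ Metric.closedBall (0 : ℂ) (1 / 2),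
          ‖f z‖ ≤ Real.exp B * ‖f z'‖ := by
  have hsub : Metric.closedBall (0 : ℂ) (1 / 2) ⊆ Metric.ball 0 1 :=
    Metric.closedBall_subset_ball (by norm_num)
  obtain ⟨w, hw, hmax⟩ := (isCompact_closedBall (0 : ℂ) (1 / 2)).exists_isMaxOn
    ⟨0, by simp⟩ (hf.continuousOn.mono hsub).norm
  have hle : ∀ z ∈ Metric.closedBall (0 : ℂ) (1 / 2), ‖f z‖ ≤ ‖f w‖ := fun z hz => hmax hz
  have hfw : 0 < ‖f w‖ := by
    rw [norm_pos_iff]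
    intro hfw0
    obtain ⟨z₁, hz₁, hfz₁⟩ := hne
    refine hfz₁ (hf.eqOn_zero_of_preconnected_of_eventuallyEq_zero
      (convex_ball (0 : ℂ) 1).isPreconnected (Metric.mem_ball_self one_pos) ?_ hz₁)
    filter_upwards [Metric.closedBall_mem_nhds (0 : ℂ) (by norm_num : (0 : ℝ) < 1 / 2)] with z hz
    have := hle z hz
    rw [hfw0, norm_zero] at this
    exact norm_le_zero_iff.1 this
  have hD : (⨆ z ∈ Metric.closedBall (0 : ℂ) (1 / 2), ‖f z‖ₑ) = ENNReal.ofReal ‖f w‖ := by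
    refine le_antisymm (iSup₂_le fun z hz => ?_) ?_
    · rw [← ofReal_norm]; exact ENNReal.ofReal_le_ofReal (hle z hz)
    · rw [ofReal_norm]
      exact le_iSup₂ (f := fun z (_ : z ∈ Metric.closedBall (0 : ℂ) (1 / 2)) => ‖f z‖ₑ) w hw
  have hN : ∀ z ∈ Metric.ball (0 : ℂ) 1, ‖f z‖ₑ ≤ ⨆ z ∈ Metric.ball (0 : ℂ) 1, ‖f z‖ₑ :=
    fun z hz => le_iSup₂ (f := fun z (_ : z ∈ Metric.ball (0 : ℂ) 1) => ‖f z‖ₑ) z hz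
  unfold doublingExponentStar doublingExponent
  rw [hD]
  set N : ℝ≥0∞ := ⨆ z ∈ Metric.ball (0 : ℂ) 1, ‖f z‖ₑ with hNdef
  rcases eq_or_ne N ⊤ with hNtop | hNtop
  · left
    rw [hNtop, ENNReal.top_div_of_ne_top ENNReal.ofReal_ne_top, ENNReal.log_top, max_eq_left le_top]
    simp [elog]
  · right
    have hNpos : 0 < N.toReal := by
      have h1 := hN w (hsub hw)
      rw [← ofReal_norm, ENNReal.ofReal_le_iff_le_toReal hNtop] at h1
      linarith
    set q : ℝ := N.toReal / ‖f w‖ with hq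
    have hq0 : 0 < q := by positivity
    have hNq : N / ENNReal.ofReal ‖f w‖ = ENNReal.ofReal q := by
      rw [hq, ENNReal.ofReal_div_of_pos hfw, ENNReal.ofReal_toReal hNtop]
    refine ⟨max (Real.log q) 2, le_max_right _ _, ?_, ?_⟩
    · have h2 : (2 : ℝ) ≤ max (Real.log q) 2 := le_max_right _ _
      have hmaxcoe : max (Real.log q : EReal) 2 = ((max (Real.log q) 2 : ℝ) : EReal) := by
        rw [EReal.coe_strictMono.monotone.map_max]; rfl
      rw [hNq, ENNReal.log_ofReal_of_pos hq0, hmaxcoe, elog,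
        EReal.toENNReal_of_ne_top (EReal.coe_ne_top _), EReal.toReal_coe,
        ENNReal.log_ofReal_of_pos (by linarith)]
    · intro z hz
      refine ⟨w, hw, ?_⟩
      have h1 := hN z hz
      rw [← ofReal_norm, ENNReal.ofReal_le_iff_le_toReal hNtop] at h1
      have h2 : q ≤ Real.exp (max (Real.log q) 2) := by
        rw [← Real.log_le_iff_le_exp hq0]; exact le_max_left _ _
      calc ‖f z‖ ≤ N.toReal := h1
        _ = q * ‖f w‖ := by rw [hq, div_mul_cancel₀ _ hfw.ne']
        _ ≤ _ := by gcongr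

theorem theorem3 :
    ∃ c : ℝ, 0 < c ∧
      ∀ f : ℂ → ℂ, AnalyticOnNhd ℂ f (Metric.ball 0 1) → f 0 = 0 →
        (∃ z ∈ Metric.ball (0 : ℂ) 1, f z ≠ 0) →
        ∀ α : ℝ, 0 < α → α ≤ 2 * Real.pi →
          ∀ θ₁ θ₂ : ℝ, θ₂ - θ₁ = α →
            ((c * α : ℝ) : EReal) / elog (doublingExponentStar 0 1 f) ≤
              ((relativeArea 1 (sector θ₁ θ₂) f : ℝ≥0∞) : EReal) := by
  obtain ⟨c, hc, H⟩ := exists_le_volume_preimage_sector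
  have hpi := Real.pi_pos
  refine ⟨c / Real.pi, by positivity, ?_⟩
  intro f hf hf0 hne α hα hα2 θ₁ θ₂ hθ
  rcases elog_doublingExponentStar_eq hf hne with htop | ⟨B, hB, hlog, hdoub⟩
  · rw [htop, EReal.div_top]
    exact EReal.coe_ennreal_nonneg _
  · have key := H f hf hf0 hne B hB hdoub θ₁ θ₂ (by linarith) (by linarith)
    rw [hθ] at key
    have hlogB : 0 < Real.log B := Real.log_pos (by linarith)
    have hball : MeasureTheory.volume (Metric.ball (0 : ℂ) 1) = ENNReal.ofReal Real.pi := by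
      rw [Complex.volume_ball, ENNReal.ofReal_one, one_pow, one_mul, ← ENNReal.ofReal_coe_nnreal,
        NNReal.coe_real_pi]
    have hrel : ENNReal.ofReal (c / Real.pi * α / Real.log B) ≤
        relativeArea 1 (sector θ₁ θ₂) f := by
      rw [relativeArea, hball, ENNReal.le_div_iff_mul_le
        (Or.inl (ENNReal.ofReal_pos.2 hpi).ne') (Or.inl ENNReal.ofReal_ne_top),
        ← ENNReal.ofReal_mul (by positivity)]
      refine le_trans (le_of_eq ?_) key
      congr 1
      field_simp
    rw [hlog, ← EReal.coe_div]
    refine le_trans ?_ (EReal.coe_ennreal_le_coe_ennreal_iff.2 hrel)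
    rw [EReal.coe_ennreal_ofReal, max_eq_left (by positivity)]
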